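/- Let $S$ be a finite (possibly empty) set of primes, let $R_S=\{x\in\mathbb Q : |x|_p\le 1 \text{ for all primes } p\notin S\}$ be the ring of $S$-integers of $\mathbb Q$, and let $\xi\in R_S$ be non-zero and of infinite multiplicative order (that is, $\xi\neq 0,\pm1$). Let $X$ be the compact group of characters of the discrete additive group $R_S$, and let $T:X\to X$ be the endomorphism dual to $x\mapsto \xi x$ on $R_S$ (the $S$-integer map over $\mathbb K=\mathbb Q$ given by $S$ and $\xi$). A closed orbit $\tau$ of $T$ of length $|\tau|=n\ge1$ is a set $\{x,Tx,\dots,T^nx=x\}$ of cardinality $n$; let $h(T)$ be the topological entropy of $T$, and for $N\ge 1$ let $$\mathcal M_T(N)=\sum_{|\tau|\le N} e^{-h(T)|\tau|},$$ the sum being over all closed orbits $\tau$ of $T$ of length at most $N$. Then $T$ has only finitely many closed orbits of each length, $0<h(T)<\infty$, and there are constants $k_T\in\mathbb Q$ and $C_T\in\mathbb R$ such that $$\mathcal M_T(N)=k_T\log N+C_T+O(1/N)\qquad(N\to\infty),$$ where the implied constant may depend on $T$. Moreover, if $\xi=2$ and $S=\{3\}$, then $k_T=\tfrac58$. -/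

import Mathlib

/-! ### Closed orbits, topological entropy and the Mertens sum of a self-map -/

/-- The closed orbits of length `n` of `T`: the sets `{x, T x, …, T^n x = x}` of cardinality `n`.
There are none for `n = 0`. -/
def closedOrbits {X : Type*} (T : X → X) (n : ℕ) : Set (Set X) :=
  {τ | ∃ x : X, T^[n] x = x ∧ τ = (fun i : ℕ => T^[i] x) '' Set.Iic n ∧ τ.ncard = n}

/-- Topological entropy of a self-map of a compact Hausdorff space, with values in `[-∞, ∞]`
(Bowen's definition, by minimal dynamical covers, for the unique uniformity that induces the
topology). -/
noncomputable def topologicalEntropy {X : Type*} [TopologicalSpace X] [CompactSpace X] [T2Space X]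
    (T : X → X) : EReal :=
  letI : UniformSpace X := uniformSpaceOfCompactR1
  Dynamics.coverEntropy T Set.univ

/-- The Mertens sum `M_T(N) = ∑_{|τ| ≤ N} exp (-h(T) |τ|)` over closed orbits `τ`, grouped by
length (meaningful when the entropy and the number of closed orbits of each length are finite). -/
noncomputable def mertensSum {X : Type*} [TopologicalSpace X] [CompactSpace X] [T2Space X]
    (T : X → X) (N : ℕ) : ℝ :=
  ∑ n ∈ Finset.Icc 1 N,
    ((closedOrbits T n).ncard : ℝ) * Real.exp (-((topologicalEntropy T).toReal * (n : ℝ)))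

/-! ### `S`-integer maps over `ℚ` -/

/-- The ring `R_S` of `S`-integers of `ℚ`: the rationals `x` with `|x|_p ≤ 1` for all primes
`p ∉ S`. -/
def sIntegers (S : Set Nat.Primes) : Subring ℚ where
  carrier := {x | ∀ p : Nat.Primes, p ∉ S → padicNorm p x ≤ 1}
  mul_mem' := by
    intro a b ha hb p hp
    have : Fact (Nat.Prime p) := ⟨p.2⟩
    rw [padicNorm.mul]
    exact mul_le_one₀ (ha p hp) (padicNorm.nonneg _) (hb p hp)
  one_mem' := by
    intro p _
    have : Fact (Nat.Prime p) := ⟨p.2⟩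
    simp
  add_mem' := by
    intro a b ha hb p hp
    have : Fact (Nat.Prime p) := ⟨p.2⟩
    exact padicNorm.nonarchimedean.trans (max_le (ha p hp) (hb p hp))
  zero_mem' := by
    intro p _
    have : Fact (Nat.Prime p) := ⟨p.2⟩
    simp
  neg_mem' := by
    intro a ha p hp
    have : Fact (Nat.Prime p) := ⟨p.2⟩
    rw [padicNorm.neg]
    exact ha p hp

/-- The additive group of `R_S`, written multiplicatively, as a discrete group (not with the
topology induced from `ℚ`). -/
def SIntegerGroup (S : Set Nat.Primes) : Type := Multiplicative (sIntegers S)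

instance (S : Set Nat.Primes) : CommGroup (SIntegerGroup S) :=
  inferInstanceAs (CommGroup (Multiplicative (sIntegers S)))

instance (S : Set Nat.Primes) : TopologicalSpace (SIntegerGroup S) := ⊥

instance (S : Set Nat.Primes) : DiscreteTopology (SIntegerGroup S) := ⟨rfl⟩

/-- Multiplication by `ξ ∈ R_S` on the discrete additive group of `R_S`. -/
def sIntegerMul (S : Set Nat.Primes) (ξ : sIntegers S) : SIntegerGroup S →ₜ* SIntegerGroup S where
  toFun x := Multiplicative.ofAdd (ξ * Multiplicative.toAdd x)
  map_one' := congrArg Multiplicative.ofAdd (mul_zero ξ)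
  map_mul' x y :=
    congrArg Multiplicative.ofAdd (mul_add ξ (Multiplicative.toAdd x) (Multiplicative.toAdd y))
  continuous_toFun := continuous_of_discreteTopology

/-- The `S`-integer map over `ℚ` given by `S` and `ξ ∈ R_S`: the endomorphism of the compact
character group of `R_S` dual to `x ↦ ξ x`. -/
noncomputable def sIntegerMap (S : Set Nat.Primes) (ξ : sIntegers S) :
    PontryaginDual (SIntegerGroup S) → PontryaginDual (SIntegerGroup S) :=
  PontryaginDual.map (sIntegerMul S ξ)

/-! Write `ξ = a / b` in lowest terms and `M = max |a| |b|`. By duality a character is fixed by `T ^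
n` exactly when it kills the ideal `(ξ ^ n - 1) R_S`, so the number of such characters is the index
of that ideal, `|a ^ n - b ^ n| f(n)` with `f(n) = ∏_{p ∈ S} |a ^ n - b ^ n|_p`
(`ncard_periodic_sIntegerMap`). The entropy is `log M` (`topologicalEntropy_sIntegerMap`). Since `ξ
≠ ±1`, `|a| ≠ |b|`, so `|a ^ n - b ^ n|` is `M ^ n` up to a relatively exponentially small error.
Points of smaller period are equally negligible, so the number of orbits of length `n`, divided by
`M ^ n`, is `f(n) / n` plus an exponentially small term (`abs_div_pow_sub_div_le`).

It remains to sum `f(n) / n`. Lifting the exponent makes `f` a rational combination of functions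
`1_{L ∣ n} ∏_{p ∈ B} |n|_p` (`exists_mem_padicSpan_prod_pow_sub_pow`). Each of these has partial
sums `k N + O(1)` with `k` rational (`exists_hasBoundedMean_of_mem_padicSpan`). Because that error
is bounded, Abel summation gives `k log N + C + O(1/N)` (`HasBoundedMean.convergesHarmonically`). -/

/-! ### Closed orbits and periodic points. -/

open Function in
/-- The forward orbit of a periodic point is listed by its first `minimalPeriod` iterates. -/
theorem image_iterate_Iic_eq_image_Iio {X : Type*} {T : X → X} {x : X} {n : ℕ}
    (hx : x ∈ periodicPts T) (hn : minimalPeriod T x ≤ n) :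
    (fun i : ℕ => T^[i] x) '' Set.Iic n = (fun i : ℕ => T^[i] x) '' Set.Iio (minimalPeriod T x) := by
  have hpos := minimalPeriod_pos_of_mem_periodicPts hx
  ext y
  constructor
  · rintro ⟨i, -, rfl⟩
    exact ⟨i % minimalPeriod T x, Nat.mod_lt _ hpos, iterate_mod_minimalPeriod_eq⟩
  · rintro ⟨i, hi, rfl⟩
    exact ⟨i, (Set.mem_Iio.1 hi).le.trans hn, rfl⟩

open Function in
theorem ncard_image_iterate_Iio_minimalPeriod {X : Type*} (T : X → X) (x : X) :
    ((fun i : ℕ => T^[i] x) '' Set.Iio (minimalPeriod T x)).ncard = minimalPeriod T x := by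
  rw [iterate_injOn_Iio_minimalPeriod.ncard_image, ← Finset.coe_Iio,
    Set.ncard_coe_finset, Nat.card_Iio]

open Function in
theorem closedOrbits_eq_image {X : Type*} (T : X → X) {n : ℕ} (hn : 0 < n) :
    closedOrbits T n =
      (fun x => (fun i : ℕ => T^[i] x) '' Set.Iio n) '' {x | minimalPeriod T x = n} := by
  ext τ
  constructor
  · rintro ⟨x, hx, rfl, hc⟩
    have hper : x ∈ periodicPts T := mk_mem_periodicPts hn hx
    have hle : minimalPeriod T x ≤ n := IsPeriodicPt.minimalPeriod_le hn hx
    rw [image_iterate_Iic_eq_image_Iio hper hle] at hc ⊢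
    rw [ncard_image_iterate_Iio_minimalPeriod] at hc
    exact ⟨x, hc, by simp only [hc]⟩
  · rintro ⟨x, rfl, rfl⟩
    have hper : x ∈ periodicPts T := minimalPeriod_pos_iff_mem_periodicPts.1 hn
    exact ⟨x, iterate_minimalPeriod, (image_iterate_Iic_eq_image_Iio hper le_rfl).symm,
      ncard_image_iterate_Iio_minimalPeriod T x⟩

theorem closedOrbits_zero {X : Type*} (T : X → X) : closedOrbits T 0 = ∅ := by
  refine Set.eq_empty_of_forall_notMem ?_
  rintro τ ⟨x, -, rfl, hc⟩
  rw [Set.ncard_eq_zero ((Set.finite_Iic 0).image _)] at hc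
  exact (Set.nonempty_Iic.image _).ne_empty hc

open Function in
theorem setOf_minimalPeriod_eq_subset {X : Type*} (T : X → X) (n : ℕ) :
    {x | minimalPeriod T x = n} ⊆ {x | T^[n] x = x} := by
  rintro x rfl
  exact iterate_minimalPeriod

theorem closedOrbits_finite {X : Type*} (T : X → X) (n : ℕ)
    (hT : 0 < n → {x | T^[n] x = x}.Finite) : (closedOrbits T n).Finite := by
  rcases n.eq_zero_or_pos with rfl | hn
  · simp [closedOrbits_zero]
  · rw [closedOrbits_eq_image T hn]
    exact ((hT hn).subset (setOf_minimalPeriod_eq_subset T n)).image _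

open Function in
-- Sending a point of minimal period `n` to its orbit has as fibres the orbits themselves, each with
-- `n` elements.
theorem mul_ncard_closedOrbits {X : Type*} (T : X → X) {n : ℕ} (hn : 0 < n)
    (hT : {x | T^[n] x = x}.Finite) :
    n * (closedOrbits T n).ncard = {x | minimalPeriod T x = n}.ncard := by
  classical
  rw [closedOrbits_eq_image T hn]
  have hQ := hT.subset (setOf_minimalPeriod_eq_subset T n)
  set Q := {x | minimalPeriod T x = n} with hQdef
  set orb : X → Set X := fun x => (fun i : ℕ => T^[i] x) '' Set.Iio n with horb
  have hcard : ∀ x ∈ Q, (orb x).ncard = n := by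
    intro x hx
    have h := ncard_image_iterate_Iio_minimalPeriod T x
    rwa [show minimalPeriod T x = n from hx] at h
  have hfin : ∀ x, (orb x).Finite := fun x => (Set.finite_Iio n).image _
  have hfib : ∀ x ∈ Q, {y ∈ Q | orb y = orb x} = orb x := by
    intro x hx
    have hper : x ∈ periodicPts T := minimalPeriod_pos_iff_mem_periodicPts.1 (hx ▸ hn)
    ext y
    constructor
    · rintro ⟨-, h⟩
      rw [← h]
      exact ⟨0, hn, rfl⟩
    · rintro ⟨i, -, rfl⟩
      have hy : T^[i] x ∈ Q := (minimalPeriod_apply_iterate hper i).trans hx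
      refine ⟨hy, Set.eq_of_subset_of_ncard_le ?_ ?_ (hfin x)⟩
      · rintro _ ⟨j, -, rfl⟩
        refine ⟨(j + i) % minimalPeriod T x, ?_, ?_⟩
        · rw [Set.mem_Iio, ← (hx : minimalPeriod T x = n)]
          exact Nat.mod_lt _ ((hx : minimalPeriod T x = n) ▸ hn)
        · simp only [iterate_mod_minimalPeriod_eq, iterate_add_apply]
      · rw [hcard _ hy, hcard _ hx]
  rw [← hQ.coe_toFinset, ← Finset.coe_image, Set.ncard_coe_finset,
    Set.ncard_coe_finset, Finset.card_eq_sum_card_image orb hQ.toFinset, Finset.sum_const_nat,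
    mul_comm]
  intro τ hτ
  obtain ⟨x, hx, rfl⟩ := Finset.mem_image.1 hτ
  rw [hQ.mem_toFinset] at hx
  have hcoe : (({a ∈ hQ.toFinset | orb a = orb x} : Finset X) : Set X) = orb x := by
    refine Eq.trans ?_ (hfib x hx)
    ext y
    simp
  rw [← Set.ncard_coe_finset, hcoe, hcard x hx]

open Function in
theorem mul_ncard_closedOrbits_le {X : Type*} (T : X → X) {n : ℕ} (hn : 0 < n)
    (hT : {x | T^[n] x = x}.Finite) :
    n * (closedOrbits T n).ncard ≤ {x | T^[n] x = x}.ncard := by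
  rw [mul_ncard_closedOrbits T hn hT]
  exact Set.ncard_le_ncard (setOf_minimalPeriod_eq_subset T n) hT

open Function in
-- A union bound over proper divisors replaces Möbius inversion: they are at most `n / 2`, so their
-- contribution will be exponentially smaller than the main term.
theorem ncard_periodic_le {X : Type*} (T : X → X) {n : ℕ} (hn : 0 < n)
    (hT : ∀ n, 0 < n → {x | T^[n] x = x}.Finite) :
    {x | T^[n] x = x}.ncard ≤
      n * (closedOrbits T n).ncard + ∑ d ∈ n.properDivisors, {x | T^[d] x = x}.ncard := by
  classical
  rw [mul_ncard_closedOrbits T hn (hT n hn)]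
  have hsub : {x | T^[n] x = x} ⊆
      {x | minimalPeriod T x = n} ∪ ⋃ d ∈ n.properDivisors, {x | T^[d] x = x} := by
    intro x hx
    have hdvd : minimalPeriod T x ∣ n := IsPeriodicPt.minimalPeriod_dvd hx
    rcases (Nat.le_of_dvd hn hdvd).eq_or_lt with h | h
    · exact Or.inl h
    · refine Or.inr ?_
      simp only [Set.mem_iUnion]
      exact ⟨_, Nat.mem_properDivisors.2 ⟨hdvd, h⟩, iterate_minimalPeriod⟩
  have hfinU : (⋃ d ∈ n.properDivisors, {x | T^[d] x = x}).Finite :=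
    n.properDivisors.finite_toSet.biUnion fun d hd =>
      hT d (Nat.pos_of_mem_properDivisors hd)
  refine (Set.ncard_le_ncard hsub ((((hT n hn).subset
    (setOf_minimalPeriod_eq_subset T n))).union hfinU)).trans
    ((Set.ncard_union_le _ _).trans (Nat.add_le_add_left ?_ _))
  exact Finset.set_ncard_biUnion_le _ _

/-! ### Functions with bounded discrepancy from a mean value -/

/-- The partial sums of `f` over `1, …, N` are `k N + O(1)`. -/
def HasBoundedMean (f : ℕ → ℝ) (k : ℝ) : Prop :=
  ∃ B : ℝ, ∀ N : ℕ, |∑ n ∈ Finset.Icc 1 N, f n - k * N| ≤ B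

namespace HasBoundedMean

variable {f g : ℕ → ℝ} {k l : ℝ}

theorem add (hf : HasBoundedMean f k) (hg : HasBoundedMean g l) :
    HasBoundedMean (fun n => f n + g n) (k + l) := by
  obtain ⟨B, hB⟩ := hf
  obtain ⟨C, hC⟩ := hg
  refine ⟨B + C, fun N => ?_⟩
  rw [Finset.sum_add_distrib]
  have := abs_add_le (∑ n ∈ Finset.Icc 1 N, f n - k * N) (∑ n ∈ Finset.Icc 1 N, g n - l * N)
  calc _ = |(∑ n ∈ Finset.Icc 1 N, f n - k * N) + (∑ n ∈ Finset.Icc 1 N, g n - l * N)| := by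
        congr 1; ring
    _ ≤ _ := this.trans (add_le_add (hB N) (hC N))

theorem const_mul (hf : HasBoundedMean f k) (c : ℝ) :
    HasBoundedMean (fun n => c * f n) (c * k) := by
  obtain ⟨B, hB⟩ := hf
  refine ⟨|c| * B, fun N => ?_⟩
  rw [← Finset.mul_sum, mul_assoc, ← mul_sub, abs_mul]
  exact mul_le_mul_of_nonneg_left (hB N) (abs_nonneg c)

theorem congr (hf : HasBoundedMean f k) (h : ∀ n, 0 < n → f n = g n) : HasBoundedMean g k := by
  obtain ⟨B, hB⟩ := hf
  refine ⟨B, fun N => ?_⟩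
  rw [← Finset.sum_congr rfl fun n hn => h n (Finset.mem_Icc.1 hn).1]
  exact hB N

theorem one : HasBoundedMean (fun _ => 1) 1 := ⟨0, fun N => by simp⟩

end HasBoundedMean

/-- Summing over the multiples of `L` is summing over the cofactors. -/
theorem sum_Icc_ite_dvd (f : ℕ → ℝ) {L : ℕ} (hL : 0 < L) (N : ℕ) :
    ∑ n ∈ Finset.Icc 1 N, (if L ∣ n then f n else 0) = ∑ n ∈ Finset.Icc 1 (N / L), f (L * n) := by
  rw [← Finset.sum_filter]
  symm
  refine Finset.sum_bij (fun n _ => L * n) ?_ ?_ ?_ fun _ _ => rfl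
  · intro n hn
    rw [Finset.mem_Icc, Nat.le_div_iff_mul_le hL] at hn
    rw [Finset.mem_filter, Finset.mem_Icc, mul_comm L n]
    exact ⟨⟨Nat.mul_pos hn.1 hL, hn.2⟩, dvd_mul_left _ _⟩
  · intro a _ b _ h
    exact Nat.eq_of_mul_eq_mul_left hL h
  · intro n hn
    rw [Finset.mem_filter, Finset.mem_Icc] at hn
    obtain ⟨⟨h1, h2⟩, m, rfl⟩ := hn
    refine ⟨m, ?_, rfl⟩
    rw [Finset.mem_Icc, Nat.le_div_iff_mul_le hL, mul_comm m L]
    exact ⟨Nat.pos_of_mul_pos_left h1, h2⟩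

theorem abs_natCast_div_sub_le (N : ℕ) {L : ℕ} (hL : 0 < L) :
    |((N / L : ℕ) : ℝ) - (N : ℝ) / L| ≤ 1 := by
  have h1 : ((N / L : ℕ) : ℝ) ≤ (N : ℝ) / L := Nat.cast_div_le
  have h2 : (N : ℝ) / L < ((N / L : ℕ) : ℝ) + 1 := by
    rw [div_lt_iff₀ (by exact_mod_cast hL)]
    exact_mod_cast (Nat.div_lt_iff_lt_mul hL).1 (Nat.lt_succ_self (N / L))
  rw [abs_le]
  constructor <;> linarith

theorem HasBoundedMean.comp_mul {f : ℕ → ℝ} {L : ℕ} (hL : 0 < L) {k : ℝ}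
    (hf : HasBoundedMean (fun n => f (L * n)) k) :
    HasBoundedMean (fun n => if L ∣ n then f n else 0) (k / L) := by
  obtain ⟨B, hB⟩ := hf
  refine ⟨B + |k|, fun N => ?_⟩
  rw [sum_Icc_ite_dvd f hL]
  have h1 := hB (N / L)
  have h2 : |k * (((N / L : ℕ) : ℝ) - (N : ℝ) / L)| ≤ |k| := by
    rw [abs_mul]
    exact mul_le_of_le_one_right (abs_nonneg k) (abs_natCast_div_sub_le N hL)
  calc _ = |(∑ n ∈ Finset.Icc 1 (N / L), f (L * n) - k * ((N / L : ℕ) : ℝ)) +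
        k * (((N / L : ℕ) : ℝ) - (N : ℝ) / L)| := by congr 1; ring
    _ ≤ _ := (abs_add_le _ _).trans (add_le_add h1 h2)

/-- If `g` is invariant under `n ↦ p n` and has mean `k`, then `n ↦ g n |n|_p` has mean
`k p / (p + 1)`. -/
theorem HasBoundedMean.mul_padicNorm {g : ℕ → ℝ} {k : ℝ} (hg : HasBoundedMean g k) {p : ℕ}
    (hp : p.Prime) (hinv : ∀ n, g (p * n) = g n) :
    HasBoundedMean (fun n => g n * (padicNorm p n : ℝ)) (k * (p / (p + 1))) := by
  have : Fact p.Prime := ⟨hp⟩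
  obtain ⟨B, hB⟩ := hg
  have hp0 : (0 : ℝ) < p := by exact_mod_cast hp.pos
  have hp2 : (2 : ℝ) ≤ p := by exact_mod_cast hp.two_le
  set k' : ℝ := k * (p / (p + 1)) with hk'
  set H : ℕ → ℝ := fun N => ∑ n ∈ Finset.Icc 1 N, g n * (padicNorm p n : ℝ) with hH
  set G : ℕ → ℝ := fun N => ∑ n ∈ Finset.Icc 1 N, g n with hG
  -- Integers prime to `p` have `|n|_p = 1` and contribute `G N - G (N / p)`; a multiple `p n`
  -- contributes `1 / p` times the term at `n`.
  have hrec : ∀ N, H N = G N - G (N / p) + (1 / p) * H (N / p) := by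
    intro N
    have h1 : ∀ n ∈ Finset.Icc 1 N, g n * (padicNorm p n : ℝ) =
        g n - (if p ∣ n then g n else 0) +
          (if p ∣ n then g n * (padicNorm p n : ℝ) else 0) := by
      intro n hn
      by_cases h : p ∣ n
      · simp [h]
      · have : padicNorm p n = 1 := (padicNorm.nat_eq_one_iff n).2 h
        simp [h, this]
    rw [hH, hG]
    simp only
    rw [Finset.sum_congr rfl h1, Finset.sum_add_distrib, Finset.sum_sub_distrib,
      sum_Icc_ite_dvd g hp.pos, sum_Icc_ite_dvd (fun n => g n * (padicNorm p n : ℝ)) hp.pos,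
      Finset.mul_sum]
    congr 1
    · simp only [hinv]
    · refine Finset.sum_congr rfl fun n _ => ?_
      rw [hinv, Nat.cast_mul, padicNorm.mul, padicNorm.padicNorm_p hp.one_lt]
      push_cast
      ring
  have hB0 : 0 ≤ B := (abs_nonneg _).trans (hB 0)
  -- `C` bounds the error added by one use of the recursion. The earlier error is multiplied by `1 /
  -- p ≤ 1 / 2`, so the bound `2 * C` reproduces itself.
  set C : ℝ := 2 * B + |k| + |k'| with hC
  have hC0 : 0 ≤ C := by positivity
  refine ⟨2 * C, fun N => ?_⟩
  change |H N - k' * N| ≤ 2 * C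
  induction N using Nat.strong_induction_on with
  | _ N ih =>
    rcases N.eq_zero_or_pos with rfl | hN
    · simp [hH, hC0]
    · have hlt : N / p < N := Nat.div_lt_self hN hp.one_lt
      have h1 := ih _ hlt
      have h2 := hB N
      have h3 := hB (N / p)
      have h4 := abs_natCast_div_sub_le N hp.pos
      -- The mean is the fixed point of the recursion.
      have hkk : k' = k - k / p + k' / p / p := by
        rw [hk']
        field_simp
        ring
      set M : ℝ := ((N / p : ℕ) : ℝ) with hM
      have h5 : |(-k + k' / p) * (M - (N : ℝ) / p)| ≤ |k| + |k'| := by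
        rw [abs_mul]
        refine (mul_le_of_le_one_right (abs_nonneg _) h4).trans ((abs_add_le _ _).trans ?_)
        rw [abs_neg, abs_div, abs_of_pos hp0]
        gcongr
        exact div_le_self (abs_nonneg _) (by linarith)
      have h6 : H N - k' * N = (G N - k * N) - (G (N / p) - k * M) +
          (1 / p) * (H (N / p) - k' * M) + (-k + k' / p) * (M - (N : ℝ) / p) := by
        rw [hrec N]
        linear_combination (-(N : ℝ)) * hkk
      have h7 : |(1 / (p : ℝ)) * (H (N / p) - k' * M)| ≤ C := by
        rw [abs_mul, abs_of_pos (by positivity : (0 : ℝ) < 1 / p)]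
        calc (1 / (p : ℝ)) * |H (N / p) - k' * M| ≤ (1 / 2) * (2 * C) := by gcongr
          _ = C := by ring
      rw [h6]
      refine (abs_add_le _ _).trans ?_
      refine (add_le_add_left ((abs_add_le _ _).trans
        (add_le_add_left (abs_sub _ _) _)) _).trans ?_
      have h2' : |G N - k * N| ≤ B := h2
      have h3' : |G (N / p) - k * M| ≤ B := h3
      linarith

/-! ### Sequences converging with error `O(1/N)` -/

/-- The sequence `u` equals `C + O(1/N)` for some constant `C`. -/
def ConvergesHarmonically (u : ℕ → ℝ) : Prop :=
  ∃ C : ℝ, (fun N => u N - C) =O[Filter.atTop] fun N : ℕ => 1 / (N : ℝ)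

namespace ConvergesHarmonically

variable {u v : ℕ → ℝ}

theorem add (hu : ConvergesHarmonically u) (hv : ConvergesHarmonically v) :
    ConvergesHarmonically fun n => u n + v n := by
  obtain ⟨C, hC⟩ := hu
  obtain ⟨D, hD⟩ := hv
  exact ⟨C + D, (hC.add hD).congr_left fun n => by ring⟩

theorem const_mul (hu : ConvergesHarmonically u) (c : ℝ) :
    ConvergesHarmonically fun n => c * u n := by
  obtain ⟨C, hC⟩ := hu
  exact ⟨c * C, (hC.const_mul_left c).congr_left fun n => by ring⟩

theorem of_bounded_div {B : ℝ} (h : ∀ n, 0 < n → |u n| ≤ B / n) : ConvergesHarmonically u := by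
  refine ⟨0, Asymptotics.IsBigO.of_bound B ?_⟩
  filter_upwards [Filter.eventually_gt_atTop 0] with n hn
  rw [sub_zero, Real.norm_eq_abs, Real.norm_of_nonneg (by positivity), mul_one_div]
  exact h n hn

/-- The increments are dominated by a telescoping sequence, so `u n - B / n` increases, `u n + B /
n` decreases, and the limit lies between them. The index is shifted by one in the proof to avoid `n
= 0`. -/
theorem of_abs_sub_le {B : ℝ} (h : ∀ n, 0 < n → |u (n + 1) - u n| ≤ B * (1 / n - 1 / (n + 1))) :
    ConvergesHarmonically u := by
  set lo : ℕ → ℝ := fun n => u (n + 1) - B / ((n : ℝ) + 1) with hlo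
  set hi : ℕ → ℝ := fun n => u (n + 1) + B / ((n : ℝ) + 1) with hhi
  have hB : 0 ≤ B := by
    have := (abs_nonneg _).trans (h 1 one_pos)
    norm_num at this
    exact this
  have hstep : ∀ n : ℕ, |u (n + 1 + 1) - u (n + 1)| ≤
      B / ((n : ℝ) + 1) - B / ((n : ℝ) + 1 + 1) := by
    intro n
    have := h (n + 1) n.succ_pos
    push_cast at this
    calc _ ≤ _ := this
      _ = _ := by ring
  have hmono : Monotone lo := monotone_nat_of_le_succ fun n => by
    have := (abs_le.1 (hstep n)).1
    simp only [hlo]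
    push_cast
    linarith
  have hanti : Antitone hi := antitone_nat_of_succ_le fun n => by
    have := (abs_le.1 (hstep n)).2
    simp only [hhi]
    push_cast
    linarith
  have hle : ∀ m n, lo m ≤ hi n := by
    intro m n
    have h1 : lo (max m n) ≤ hi (max m n) := by
      have : 0 ≤ B / (((max m n : ℕ) : ℝ) + 1) := by positivity
      simp only [hlo, hhi]
      linarith
    exact (hmono (le_max_left m n)).trans (h1.trans (hanti (le_max_right m n)))
  have hbdd : BddAbove (Set.range lo) := ⟨hi 0, by rintro _ ⟨m, rfl⟩; exact hle m 0⟩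
  refine ⟨⨆ m, lo m, Asymptotics.IsBigO.of_bound B ?_⟩
  filter_upwards [Filter.eventually_gt_atTop 0] with n hn
  obtain ⟨m, rfl⟩ := Nat.exists_eq_succ_of_ne_zero hn.ne'
  rw [Real.norm_eq_abs, Real.norm_of_nonneg (by positivity), mul_one_div, abs_le]
  have h1 : lo m ≤ ⨆ m, lo m := le_ciSup hbdd m
  have h2 : ⨆ m, lo m ≤ hi m := ciSup_le fun j => hle j m
  simp only [hlo, hhi] at h1 h2
  push_cast [Nat.succ_eq_add_one]
  constructor <;> linarith

end ConvergesHarmonically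

/-- Euler's constant lies between `H_n - log (n + 1)` and `H_n - log n`, which differ by at most `1
/ n`. -/
theorem convergesHarmonically_sum_inv_sub_log :
    ConvergesHarmonically fun N => ∑ n ∈ Finset.Icc 1 N, 1 / (n : ℝ) - Real.log N := by
  refine ⟨Real.eulerMascheroniConstant, Asymptotics.IsBigO.of_bound 1 ?_⟩
  filter_upwards [Filter.eventually_gt_atTop 0] with n hn
  have hn' : (0 : ℝ) < n := by exact_mod_cast hn
  have h1 := Real.eulerMascheroniSeq_lt_eulerMascheroniConstant n
  have h2 := Real.eulerMascheroniConstant_lt_eulerMascheroniSeq' n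
  have h3 : Real.log (n + 1) - Real.log n ≤ 1 / n := by
    rw [← Real.log_div (by positivity) hn'.ne']
    refine (Real.log_le_sub_one_of_pos (by positivity)).trans (le_of_eq ?_)
    field_simp
    ring
  have h4 : (harmonic n : ℝ) = ∑ i ∈ Finset.Icc 1 n, 1 / (i : ℝ) := by
    rw [harmonic_eq_sum_Icc]
    push_cast
    simp
  rw [Real.eulerMascheroniSeq, h4] at h1
  rw [Real.eulerMascheroniSeq', if_neg hn.ne', h4] at h2
  rw [Real.norm_eq_abs, Real.norm_of_nonneg (by positivity), one_mul, abs_le]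
  constructor <;> linarith

theorem HasBoundedMean.convergesHarmonically {f : ℕ → ℝ} {k : ℝ} (hf : HasBoundedMean f k) :
    ConvergesHarmonically fun N => ∑ n ∈ Finset.Icc 1 N, f n / n - k * Real.log N := by
  obtain ⟨B, hB⟩ := hf
  set E : ℕ → ℝ := fun N => ∑ n ∈ Finset.Icc 1 N, f n - k * N with hE
  have hEs : ∀ N, E (N + 1) = E N + (f (N + 1) - k) := by
    intro N
    simp only [hE]
    rw [Finset.sum_Icc_succ_top (by omega)]
    push_cast
    ring
  have hB0 : 0 ≤ B := (abs_nonneg _).trans (hB 0)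
  -- Abel summation: after subtracting the boundary term, the increment is `E (n + 1)` times a
  -- telescoping difference, with `E` bounded.
  have h1 : ConvergesHarmonically fun N =>
      ∑ n ∈ Finset.Icc 1 N, (f n - k) / n - E N / (N + 1) := by
    refine ConvergesHarmonically.of_abs_sub_le (B := 2 * B) fun n hn => ?_
    have hn' : (0 : ℝ) < n := by exact_mod_cast hn
    rw [Finset.sum_Icc_succ_top (by omega), hEs n]
    push_cast
    have h2 : ∑ i ∈ Finset.Icc 1 n, (f i - k) / i + (f (n + 1) - k) / (n + 1) -
        (E n + (f (n + 1) - k)) / (n + 1 + 1) -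
        (∑ i ∈ Finset.Icc 1 n, (f i - k) / i - E n / (n + 1)) =
        E (n + 1) * (1 / (n + 1) - 1 / (n + 1 + 1)) := by
      rw [hEs n]
      field_simp
      ring
    rw [h2, abs_mul]
    have h3 : (0 : ℝ) ≤ 1 / (n + 1) - 1 / (n + 1 + 1) := by
      rw [sub_nonneg]
      exact one_div_le_one_div_of_le (by positivity) (by linarith)
    rw [abs_of_nonneg h3]
    have h4 : (1 : ℝ) / (n + 1) - 1 / (n + 1 + 1) ≤ 2 * (1 / n - 1 / (n + 1)) := by
      rw [div_sub_div _ _ (by positivity) (by positivity),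
        div_sub_div _ _ (by positivity) (by positivity), ← mul_div_assoc,
        div_le_div_iff₀ (by positivity) (by positivity)]
      nlinarith
    calc |E (n + 1)| * (1 / ((n : ℝ) + 1) - 1 / (n + 1 + 1))
        ≤ B * (2 * (1 / n - 1 / (n + 1))) := mul_le_mul (hB _) h4 h3 hB0
      _ = _ := by ring
  have h2 : ConvergesHarmonically fun N => E N / (N + 1) := by
    refine ConvergesHarmonically.of_bounded_div (B := B) fun n hn => ?_
    have hn' : (0 : ℝ) < n := by exact_mod_cast hn
    rw [abs_div, abs_of_pos (by positivity : (0 : ℝ) < n + 1)]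
    exact div_le_div₀ hB0 (hB n) hn' (by linarith)
  have h3 := (h1.add h2).add (convergesHarmonically_sum_inv_sub_log.const_mul k)
  convert h3 using 2 with N
  simp only [sub_div, Finset.sum_sub_distrib]
  rw [mul_sub, Finset.mul_sum]
  simp only [mul_one_div]
  ring

/-- Since `n ^ 2 * r ^ n` is bounded, the terms are dominated by `1 / n - 1 / (n + 1)`. -/
theorem convergesHarmonically_sum_of_geometric {e : ℕ → ℝ} {c r : ℝ} (hr0 : 0 ≤ r) (hr1 : r < 1)
    (he : ∀ n, 0 < n → |e n| ≤ c * r ^ n) :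
    ConvergesHarmonically fun N => ∑ n ∈ Finset.Icc 1 N, e n := by
  have ht := tendsto_pow_const_mul_const_pow_of_abs_lt_one 2 (abs_lt.2 ⟨by linarith, hr1⟩)
  obtain ⟨D, hD⟩ := ht.bddAbove_range
  have hD' : ∀ n : ℕ, (n : ℝ) ^ 2 * r ^ n ≤ D := fun n => hD ⟨n, rfl⟩
  have hc : 0 ≤ |c| := abs_nonneg c
  refine ConvergesHarmonically.of_abs_sub_le (B := |c| * D) fun n hn => ?_
  have hn' : (0 : ℝ) < n := by exact_mod_cast hn
  rw [Finset.sum_Icc_succ_top (by omega), add_sub_cancel_left]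
  refine (he (n + 1) n.succ_pos).trans ?_
  have h1 := hD' (n + 1)
  push_cast at h1
  have h2 : (1 : ℝ) / (n + 1) ^ 2 ≤ 1 / n - 1 / (n + 1) := by
    rw [div_sub_div _ _ (by positivity) (by positivity),
        div_le_div_iff₀ (by positivity) (by positivity)]
    nlinarith
  have h3 : r ^ (n + 1) ≤ D * (1 / (n + 1) ^ 2) := by
    rw [mul_one_div, le_div_iff₀ (by positivity)]
    linarith
  have hD0 : 0 ≤ D := le_trans (by positivity) h1
  calc c * r ^ (n + 1) ≤ |c| * r ^ (n + 1) :=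
        mul_le_mul_of_nonneg_right (le_abs_self c) (by positivity)
    _ ≤ |c| * (D * (1 / n - 1 / (n + 1))) := by gcongr; exact h3.trans (by gcongr)
    _ = _ := by ring

/-! ### The `p`-adic size of `a ^ n - b ^ n` -/

theorem padicNorm_mul_eq_of_emultiplicity_add {p : ℕ} [Fact p.Prime] {x y z : ℤ} (hx : x ≠ 0)
    (hy : y ≠ 0) (hz : z ≠ 0)
    (h : emultiplicity (p : ℤ) x = emultiplicity (p : ℤ) y + emultiplicity (p : ℤ) z) :
    padicNorm p x = padicNorm p y * padicNorm p z := by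
  have hp : Prime (p : ℤ) := Nat.prime_iff_prime_int.1 Fact.out
  rw [← emultiplicity_mul hp] at h
  have hyz : y * z ≠ 0 := mul_ne_zero hy hz
  have key : padicValInt p x = padicValInt p (y * z) := by
    rw [padicValInt.of_ne_one_ne_zero (Fact.out : p.Prime).ne_one hx,
      padicValInt.of_ne_one_ne_zero (Fact.out : p.Prime).ne_one hyz]
    exact multiplicity_eq_of_emultiplicity_eq h
  rw [← padicNorm.mul, ← Int.cast_mul, padicNorm.eq_zpow_of_nonzero (by exact_mod_cast hx),
    padicNorm.eq_zpow_of_nonzero (by exact_mod_cast hyz), padicValRat.of_int, padicValRat.of_int,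
    key]

theorem padicNorm_int_eq_one {p : ℕ} [Fact p.Prime] {z : ℤ} (h : ¬ (p : ℤ) ∣ z) :
    padicNorm p z = 1 :=
  (padicNorm.int_eq_one_iff z).2 h

section PadicPow

variable {p : ℕ} [Fact p.Prime] {a b : ℤ}

theorem padicNorm_pow_sub_pow_of_dvd (hab : IsCoprime a b) (h : (p : ℤ) ∣ a ∨ (p : ℤ) ∣ b) {n : ℕ}
    (hn : 0 < n) : padicNorm p ((a ^ n - b ^ n : ℤ) : ℚ) = 1 := by
  have hp : Prime (p : ℤ) := Nat.prime_iff_prime_int.1 Fact.out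
  refine padicNorm_int_eq_one fun hd => ?_
  rcases h with h | h
  · have h1 : (p : ℤ) ∣ b ^ n := by
      simpa using dvd_sub (dvd_pow h hn.ne') hd
    exact hp.not_isUnit (hab.isUnit_of_dvd' h (hp.dvd_of_dvd_pow h1))
  · have h1 : (p : ℤ) ∣ a ^ n := by
      simpa using dvd_add hd (dvd_pow h hn.ne')
    exact hp.not_isUnit (hab.isUnit_of_dvd' (hp.dvd_of_dvd_pow h1) h)

/-- Lifting the exponent, applied to `a ^ m` and `b ^ m` with exponent `n / m`. -/
theorem padicNorm_pow_sub_pow_of_odd (hodd : Odd p) (ha : ¬ (p : ℤ) ∣ a)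
    (hab : ∀ n : ℕ, 0 < n → a ^ n - b ^ n ≠ 0) {m : ℕ} (hm : 0 < m)
    (hdvd : ∀ n : ℕ, (p : ℤ) ∣ a ^ n - b ^ n ↔ m ∣ n) {n : ℕ} (hn : 0 < n) :
    padicNorm p ((a ^ n - b ^ n : ℤ) : ℚ) = if m ∣ n then
      padicNorm p ((a ^ m - b ^ m : ℤ) : ℚ) / padicNorm p m * padicNorm p n else 1 := by
  have hp : Prime (p : ℤ) := Nat.prime_iff_prime_int.1 Fact.out
  split_ifs with h
  · obtain ⟨j, rfl⟩ := h
    have hj : 0 < j := Nat.pos_of_mul_pos_left hn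
    have hm0 : padicNorm p (m : ℚ) ≠ 0 := padicNorm.nonzero (by exact_mod_cast hm.ne')
    have h1 := Int.emultiplicity_pow_sub_pow Fact.out hodd ((hdvd m).2 dvd_rfl)
      (fun h => ha (hp.dvd_of_dvd_pow h)) j
    rw [← pow_mul, ← pow_mul, ← Int.natCast_emultiplicity] at h1
    rw [padicNorm_mul_eq_of_emultiplicity_add (hab _ hn) (hab m hm)
      (by exact_mod_cast hj.ne' : (j : ℤ) ≠ 0) h1, Nat.cast_mul, padicNorm.mul, Int.cast_natCast]
    field_simp
  · exact padicNorm_int_eq_one fun hd => h ((hdvd n).1 hd)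

theorem exists_dvd_pow_sub_pow_iff (ha : ¬ (p : ℤ) ∣ a) (hb : ¬ (p : ℤ) ∣ b) :
    ∃ m : ℕ, 0 < m ∧ ∀ n : ℕ, (p : ℤ) ∣ a ^ n - b ^ n ↔ m ∣ n := by
  have ha' : (a : ZMod p) ≠ 0 := fun h => ha ((ZMod.intCast_zmod_eq_zero_iff_dvd a p).1 h)
  have hb' : (b : ZMod p) ≠ 0 := fun h => hb ((ZMod.intCast_zmod_eq_zero_iff_dvd b p).1 h)
  have hu : IsUnit ((a : ZMod p) / b) := (div_ne_zero ha' hb').isUnit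
  -- `p` divides `a ^ n - b ^ n` exactly when `(a / b) ^ n = 1` modulo `p`.
  refine ⟨orderOf ((a : ZMod p) / b), ?_, fun n => ?_⟩
  · obtain ⟨u, hu⟩ := hu
    rw [← hu, orderOf_units]
    exact orderOf_pos u
  · rw [orderOf_dvd_iff_pow_eq_one, div_pow, div_eq_one_iff_eq (pow_ne_zero n hb'),
      ← ZMod.intCast_zmod_eq_zero_iff_dvd]
    push_cast
    exact sub_eq_zero

/-- For even `n`, lifting the exponent at `2` reads `v(a ^ n - b ^ n) + 1 = v(a + b) + v(a - b) +
v(n)`; the extra `1` is the division by `|2|_2`. For odd `n` the valuation is that of `a - b`. -/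
theorem padicNorm_two_pow_sub_pow (ha : ¬ (2 : ℤ) ∣ a) (hb : ¬ (2 : ℤ) ∣ b)
    (hab : ∀ n : ℕ, 0 < n → a ^ n - b ^ n ≠ 0) {n : ℕ} (hn : 0 < n) :
    padicNorm 2 ((a ^ n - b ^ n : ℤ) : ℚ) = if 2 ∣ n then
      padicNorm 2 ((a ^ 2 - b ^ 2 : ℤ) : ℚ) / padicNorm 2 (2 : ℕ) * padicNorm 2 n
      else padicNorm 2 ((a - b : ℤ) : ℚ) := by
  have h2 : Prime (2 : ℤ) := Int.prime_two
  have hsub : (2 : ℤ) ∣ a - b := by omega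
  split_ifs with h
  · have h1 := Int.two_pow_sub_pow hsub ha (even_iff_two_dvd.2 h)
    have hn0 : (n : ℤ) ≠ 0 := by exact_mod_cast hn.ne'
    have h0 : emultiplicity (2 : ℤ) 2 = 1 :=
      (Int.finiteMultiplicity_iff.2 ⟨by norm_num, two_ne_zero⟩).emultiplicity_self
    rw [← h0, ← emultiplicity_mul h2, ← emultiplicity_mul h2, mul_comm (a + b)] at h1
    have h3 := hab 2 two_pos
    have h3' : (a - b) * (a + b) ≠ 0 := by
      rw [mul_comm, ← sq_sub_sq]
      exact h3
    have h4 := padicNorm_mul_eq_of_emultiplicity_add (p := 2)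
      (mul_ne_zero (hab n hn) two_ne_zero) h3' hn0 (by exact_mod_cast h1)
    rw [Int.cast_mul, padicNorm.mul, mul_comm (a - b), ← sq_sub_sq] at h4
    have h5 : padicNorm 2 ((2 : ℕ) : ℚ) ≠ 0 := padicNorm.nonzero (by norm_num)
    rw [div_mul_eq_mul_div, eq_div_iff h5]
    exact_mod_cast h4
  · have h1 := emultiplicity_pow_sub_pow_of_prime h2 hsub ha
      (fun hd => h (by exact_mod_cast hd) : ¬ (2 : ℤ) ∣ (n : ℤ))
    have hab1 := hab 1 one_pos
    rw [pow_one, pow_one] at hab1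
    have h4 := padicNorm_mul_eq_of_emultiplicity_add (p := 2) (hab n hn) hab1 one_ne_zero
      (by rw [emultiplicity_of_one_right (by exact_mod_cast h2.not_isUnit), add_zero]
          exact_mod_cast h1)
    simpa using h4

/-- Along the positive integers, `|a ^ n - b ^ n|_p` is a constant multiple of `|n|_p` on the
multiples of some `m`, and constant elsewhere. -/
theorem exists_padicNorm_pow_sub_pow_eq_ite (hcop : IsCoprime a b)
    (hab : ∀ n : ℕ, 0 < n → a ^ n - b ^ n ≠ 0) :
    ∃ (m : ℕ) (c α β : ℚ), 0 < m ∧ ∀ n : ℕ, 0 < n →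
      padicNorm p ((a ^ n - b ^ n : ℤ) : ℚ) =
        if m ∣ n then c * padicNorm p n + β else α := by
  by_cases h : (p : ℤ) ∣ a ∨ (p : ℤ) ∣ b
  · refine ⟨1, 0, 0, 1, one_pos, fun n hn => ?_⟩
    rw [padicNorm_pow_sub_pow_of_dvd hcop h hn]
    simp
  · push Not at h
    rcases (Fact.out : p.Prime).eq_two_or_odd' with rfl | hodd
    · refine ⟨2, padicNorm 2 ((a ^ 2 - b ^ 2 : ℤ) : ℚ) / padicNorm 2 (2 : ℕ),
        padicNorm 2 ((a - b : ℤ) : ℚ), 0, two_pos, fun n hn => ?_⟩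
      rw [add_zero]
      exact padicNorm_two_pow_sub_pow (by exact_mod_cast h.1) (by exact_mod_cast h.2) hab hn
    · obtain ⟨m, hm, hdvd⟩ := exists_dvd_pow_sub_pow_iff h.1 h.2
      refine ⟨m, padicNorm p ((a ^ m - b ^ m : ℤ) : ℚ) / padicNorm p m, 1, 0, hm, fun n hn => ?_⟩
      rw [add_zero]
      exact padicNorm_pow_sub_pow_of_odd hodd h.1 hab hm hdvd hn

end PadicPow

/-! ### Mean values of products of `p`-adic sizes -/

/-- The rational span of the functions `n ↦ 1_{L ∣ n} ∏_{p ∈ B} |n|_p` with `L ≥ 1` and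
`B ⊆ A`. -/
def padicSpan (A : Finset ℕ) : Submodule ℚ (ℕ → ℚ) :=
  Submodule.span ℚ {f | ∃ (L : ℕ) (B : Finset ℕ), 0 < L ∧ B ⊆ A ∧
    f = fun n : ℕ => if L ∣ n then ∏ p ∈ B, padicNorm p n else 0}

theorem mem_padicSpan {A B : Finset ℕ} {L : ℕ} (hL : 0 < L) (hB : B ⊆ A) :
    (fun n : ℕ => if L ∣ n then ∏ p ∈ B, padicNorm p n else 0) ∈ padicSpan A :=
  Submodule.subset_span ⟨L, B, hL, hB, rfl⟩

theorem one_mem_padicSpan (A : Finset ℕ) : (1 : ℕ → ℚ) ∈ padicSpan A := by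
  have h := mem_padicSpan (A := A) one_pos (Finset.empty_subset A)
  simp only [one_dvd, if_true, Finset.prod_empty] at h
  exact h

/-- The factor is `α + (β - α) 1_{m ∣ n} + c 1_{m ∣ n} |n|_p`, and indicators of divisibility
multiply through the lcm. As `p ∉ A`, no `|n|_p` gets squared. -/
theorem mul_ite_mem_padicSpan {A : Finset ℕ} {p : ℕ} (hp : p ∉ A) {m : ℕ} (hm : 0 < m)
    (c α β : ℚ) {f : ℕ → ℚ} (hf : f ∈ padicSpan A) :
    (f * fun n : ℕ => if m ∣ n then c * padicNorm p n + β else α) ∈ padicSpan (insert p A) := by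
  induction hf using Submodule.span_induction with
  | mem f hf =>
    obtain ⟨L, B, hL, hB, rfl⟩ := hf
    have hpB : p ∉ B := fun h => hp (hB h)
    have hlcm : 0 < Nat.lcm L m := Nat.lcm_pos hL hm
    have hB' : B ⊆ insert p A := hB.trans (Finset.subset_insert p A)
    have h1 := Submodule.smul_mem _ α (mem_padicSpan hL hB')
    have h2 := Submodule.smul_mem _ (β - α) (mem_padicSpan hlcm hB')
    have h3 := Submodule.smul_mem _ c (mem_padicSpan hlcm (Finset.insert_subset_insert p hB))
    convert Submodule.add_mem _ (Submodule.add_mem _ h1 h2) h3 using 1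
    ext n
    by_cases hLn : L ∣ n <;> by_cases hmn : m ∣ n <;>
      simp [hLn, hmn, Nat.lcm_dvd_iff, Finset.prod_insert hpB]
    all_goals ring
  | zero => rw [zero_mul]; exact Submodule.zero_mem _
  | add f g _ _ hf hg => rw [add_mul]; exact Submodule.add_mem _ hf hg
  | smul r f _ hf => rw [smul_mul_assoc]; exact Submodule.smul_mem _ r hf

theorem exists_hasBoundedMean_prod_padicNorm (B : Finset ℕ) (hB : ∀ p ∈ B, p.Prime) :
    ∃ k : ℚ, HasBoundedMean (fun n => ((∏ p ∈ B, padicNorm p n : ℚ) : ℝ)) k := by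
  induction B using Finset.induction_on with
  | empty => exact ⟨1, by simpa using HasBoundedMean.one⟩
  | insert p B hp ih =>
    obtain ⟨k, hk⟩ := ih fun q hq => hB q (Finset.mem_insert_of_mem hq)
    have hpp := hB p (Finset.mem_insert_self p B)
    refine ⟨k * (p / (p + 1)), ?_⟩
    -- The product over the other primes does not change under `n ↦ p n`.
    have h := hk.mul_padicNorm hpp fun n => ?_
    · convert h using 1
      · ext n
        rw [Finset.prod_insert hp, mul_comm]
        push_cast
        rfl
      · push_cast
        rfl
    · congr 1
      refine Finset.prod_congr rfl fun q hq => ?_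
      have hq' : q.Prime := hB q (Finset.mem_insert_of_mem hq)
      have : Fact q.Prime := ⟨hq'⟩
      have hne : ¬ q ∣ p := fun hd => hp (((Nat.prime_dvd_prime_iff_eq hq' hpp).1 hd) ▸ hq)
      rw [Nat.cast_mul, padicNorm.mul, (padicNorm.nat_eq_one_iff p).2 hne, one_mul]

theorem exists_hasBoundedMean_of_mem_padicSpan {A : Finset ℕ} (hA : ∀ p ∈ A, p.Prime) {f : ℕ → ℚ}
    (hf : f ∈ padicSpan A) : ∃ k : ℚ, HasBoundedMean (fun n => (f n : ℝ)) k := by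
  induction hf using Submodule.span_induction with
  | mem f hf =>
    obtain ⟨L, B, hL, hB, rfl⟩ := hf
    obtain ⟨k, hk⟩ := exists_hasBoundedMean_prod_padicNorm B fun p hp => hA p (hB hp)
    have h1 := hk.const_mul ((∏ p ∈ B, padicNorm p L : ℚ) : ℝ)
    have h2 : HasBoundedMean (fun n => ((∏ p ∈ B, padicNorm p (L * n : ℕ) : ℚ) : ℝ))
        (((∏ p ∈ B, padicNorm p L : ℚ) : ℝ) * k) := by
      refine h1.congr fun n _ => ?_
      rw [← Rat.cast_mul, ← Finset.prod_mul_distrib]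
      congr 1
      refine Finset.prod_congr rfl fun q hq => ?_
      have : Fact q.Prime := ⟨hA q (hB hq)⟩
      rw [Nat.cast_mul, padicNorm.mul]
    refine ⟨(∏ p ∈ B, padicNorm p L) * k / L, ?_⟩
    have h3 := HasBoundedMean.comp_mul
      (f := fun n => ((∏ p ∈ B, padicNorm p (n : ℕ) : ℚ) : ℝ)) hL h2
    convert h3 using 1
    · ext n
      split_ifs with h <;> simp [h]
    · push_cast
      rfl
  | zero => exact ⟨0, 0, fun N => by simp⟩
  | add f g _ _ hf hg =>
    obtain ⟨k, hk⟩ := hf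
    obtain ⟨l, hl⟩ := hg
    exact ⟨k + l, by simpa using hk.add hl⟩
  | smul r f _ hf =>
    obtain ⟨k, hk⟩ := hf
    exact ⟨r * k, by simpa using hk.const_mul r⟩

theorem exists_mem_padicSpan_prod_pow_sub_pow {a b : ℤ} (hcop : IsCoprime a b)
    (hab : ∀ n : ℕ, 0 < n → a ^ n - b ^ n ≠ 0) (A : Finset ℕ) (hA : ∀ p ∈ A, p.Prime) :
    ∃ g ∈ padicSpan A, ∀ n : ℕ, 0 < n → ∏ p ∈ A, padicNorm p ((a ^ n - b ^ n : ℤ) : ℚ) = g n := by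
  induction A using Finset.induction_on with
  | empty => exact ⟨1, one_mem_padicSpan _, fun n _ => by simp⟩
  | insert p A hp ih =>
    obtain ⟨g, hg, hgn⟩ := ih fun q hq => hA q (Finset.mem_insert_of_mem hq)
    have : Fact p.Prime := ⟨hA p (Finset.mem_insert_self p A)⟩
    obtain ⟨m, c, α, β, hm, h⟩ := exists_padicNorm_pow_sub_pow_eq_ite (p := p) hcop hab
    refine ⟨_, mul_ite_mem_padicSpan hp hm c α β hg, fun n hn => ?_⟩
    rw [Finset.prod_insert hp, hgn n hn, h n hn, mul_comm]
    rfl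

theorem exists_hasBoundedMean_prod_pow_sub_pow {a b : ℤ} (hcop : IsCoprime a b)
    (hab : ∀ n : ℕ, 0 < n → a ^ n - b ^ n ≠ 0) (A : Finset ℕ) (hA : ∀ p ∈ A, p.Prime) :
    ∃ k : ℚ, HasBoundedMean
      (fun n => ((∏ p ∈ A, padicNorm p ((a ^ n - b ^ n : ℤ) : ℚ) : ℚ) : ℝ)) k := by
  obtain ⟨g, hg, hgn⟩ := exists_mem_padicSpan_prod_pow_sub_pow hcop hab A hA
  obtain ⟨k, hk⟩ := exists_hasBoundedMean_of_mem_padicSpan hA hg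
  exact ⟨k, hk.congr fun n hn => by rw [hgn n hn]⟩

theorem three_dvd_two_pow_sub_one_iff (n : ℕ) : ((3 : ℕ) : ℤ) ∣ 2 ^ n - 1 ^ n ↔ 2 ∣ n := by
  rw [one_pow, Nat.cast_ofNat]
  have h (m : ℕ) : (3 : ℤ) ∣ 2 ^ (2 * m) - 1 := by
    have h := sub_dvd_pow_sub_pow ((2 : ℤ) ^ 2) 1 m
    rwa [one_pow, show (2 : ℤ) ^ 2 - 1 = 3 by norm_num, ← pow_mul] at h
  rcases n.even_or_odd' with ⟨m, rfl | rfl⟩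
  · simpa using h m
  · have := h m
    rw [pow_succ]
    omega

/-- Odd `n` give the value `1`, of density `1/2`. Even `n` give `|n|_3 / 3`, contributing `(1/3)
(1/2) (3/4) = 1/8`. -/
theorem hasBoundedMean_padicNorm_three_two_pow_sub_one :
    HasBoundedMean (fun n => (padicNorm 3 ((2 ^ n - 1 ^ n : ℤ) : ℚ) : ℝ)) (5 / 8 : ℝ) := by
  have : Fact (Nat.Prime 3) := ⟨Nat.prime_three⟩
  have h3 : HasBoundedMean (fun n => (1 : ℝ) * (padicNorm 3 n : ℝ))
      (1 * ((3 : ℕ) / ((3 : ℕ) + 1))) :=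
    HasBoundedMean.one.mul_padicNorm Nat.prime_three fun _ => rfl
  have h2 : padicNorm 3 ((2 : ℕ) : ℚ) = 1 := (padicNorm.nat_eq_one_iff 2).2 (by norm_num)
  have h33 : padicNorm 3 (((2 : ℤ) ^ 2 - 1 ^ 2 : ℤ) : ℚ) = 3⁻¹ := by
    have := padicNorm.padicNorm_p (p := 3) (by norm_num)
    norm_num at this ⊢
    exact this
  have heven : HasBoundedMean (fun n : ℕ => if 2 ∣ n then (1 : ℝ) * (padicNorm 3 n : ℝ) else 0)
      (1 * ((3 : ℕ) / ((3 : ℕ) + 1)) / (2 : ℕ)) := by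
    refine HasBoundedMean.comp_mul (f := fun n : ℕ => (1 : ℝ) * (padicNorm 3 n : ℝ)) two_pos
      (h3.congr fun n _ => ?_)
    rw [Nat.cast_mul, padicNorm.mul, h2, one_mul (padicNorm 3 (n : ℚ))]
  have hind : HasBoundedMean (fun n : ℕ => if 2 ∣ n then (1 : ℝ) else 0) (1 / (2 : ℕ)) :=
    HasBoundedMean.comp_mul (f := fun _ => 1) two_pos HasBoundedMean.one
  have h := (HasBoundedMean.one.add (hind.const_mul (-1))).add (heven.const_mul 3⁻¹)
  have hk : (1 : ℝ) + -1 * (1 / (2 : ℕ)) + 3⁻¹ * (1 * ((3 : ℕ) / ((3 : ℕ) + 1)) / (2 : ℕ)) =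
      5 / 8 := by norm_num
  rw [hk] at h
  refine h.congr fun n hn => ?_
  have hpow : ∀ n : ℕ, 0 < n → (2 : ℤ) ^ n - 1 ^ n ≠ 0 := fun n hn => by
    rw [one_pow, sub_ne_zero]
    exact (one_lt_pow₀ (by norm_num) hn.ne').ne'
  rw [padicNorm_pow_sub_pow_of_odd (p := 3) (by decide) (by norm_num) hpow two_pos
    three_dvd_two_pow_sub_one_iff hn, h2, h33]
  split_ifs
  · push_cast
    ring
  · norm_num

/-! ### The ring of `S`-integers -/

section SIntegers

variable {S : Set Nat.Primes}

theorem mem_of_dvd_den {x : ℚ} (hx : x ∈ sIntegers S) {p : Nat.Primes} (h : (p : ℕ) ∣ x.den) :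
    p ∈ S := by
  by_contra hp
  have : Fact (p : ℕ).Prime := ⟨p.2⟩
  have h1 : padicNorm p x ≤ 1 := hx p hp
  have h2 : padicNorm p (x.den : ℚ) < 1 := (padicNorm.nat_lt_one_iff _).2 h
  have h3 : padicNorm p (x.num : ℚ) = 1 := padicNorm_int_eq_one fun hn =>
    p.2.one_lt.ne' (Nat.eq_one_of_dvd_coprimes x.reduced (Int.natCast_dvd.1 hn) h)
  have h4 : padicNorm p x * padicNorm p (x.den : ℚ) = 1 := by
    rw [← padicNorm.mul, Rat.mul_den_eq_num, h3]
  have h5 : 0 ≤ padicNorm p (x.den : ℚ) := padicNorm.nonneg _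
  nlinarith

theorem inv_natCast_mem_sIntegers {v : ℕ} (hv : ∀ p : Nat.Primes, (p : ℕ) ∣ v → p ∈ S) :
    (v : ℚ)⁻¹ ∈ sIntegers S := by
  intro p hp
  have : Fact (p : ℕ).Prime := ⟨p.2⟩
  have h1 : padicNorm p (v : ℚ) = 1 := (padicNorm.nat_eq_one_iff v).2 fun h => hp (hv p h)
  rw [← one_div, padicNorm.div, padicNorm.one, h1, div_one]

theorem isUnit_natCast_sIntegers {v : ℕ} (hv0 : v ≠ 0)
    (hv : ∀ p : Nat.Primes, (p : ℕ) ∣ v → p ∈ S) : IsUnit (v : sIntegers S) := by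
  refine IsUnit.of_mul_eq_one ⟨_, inv_natCast_mem_sIntegers hv⟩ (Subtype.ext ?_)
  push_cast
  exact mul_inv_cancel₀ (by exact_mod_cast hv0)

/-- Quotients of `R_S` by an integer prime to `S`. -/
theorem natCard_sIntegers_quotient {m : ℕ} (hm : ∀ p ∈ S, ¬ ((p : Nat.Primes) : ℕ) ∣ m) :
    Nat.card (sIntegers S ⧸ Ideal.span {(m : sIntegers S)}) = m := by
  have hcop : ∀ x : sIntegers S, Nat.Coprime m (x : ℚ).den := by
    intro x
    refine Nat.Coprime.symm (Nat.coprime_of_dvd fun p hp h1 h2 => ?_)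
    exact hm _ (mem_of_dvd_den x.2 (p := ⟨p, hp⟩) h1) h2
  set φ : ℤ →+* sIntegers S ⧸ Ideal.span {(m : sIntegers S)} := Int.castRingHom _ with hφ
  have hφmk : ∀ k : ℤ, φ k = Ideal.Quotient.mk _ (k : sIntegers S) := fun k => by simp [hφ]
  have hsurj : Function.Surjective φ := by
    intro y
    obtain ⟨x, rfl⟩ := Ideal.Quotient.mk_surjective y
    -- `t` inverts the denominator modulo `m`, so `num * t` is an integer congruent to `x`.
    obtain ⟨r, t, hrt⟩ := Nat.isCoprime_iff_coprime.2 (hcop x)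
    have hinv := inv_natCast_mem_sIntegers (S := S) (v := (x : ℚ).den)
      fun p hp => mem_of_dvd_den x.2 hp
    refine ⟨(x : ℚ).num * t, ?_⟩
    rw [hφmk, eq_comm, Ideal.Quotient.eq, Ideal.mem_span_singleton]
    refine ⟨((x : ℚ).num : sIntegers S) * r * ⟨_, hinv⟩, Subtype.ext ?_⟩
    have hden : ((x : ℚ).den : ℚ) ≠ 0 := by exact_mod_cast (x : ℚ).den_ne_zero
    have h1 : (x : ℚ) = (x : ℚ).num * ((x : ℚ).den : ℚ)⁻¹ := by
      rw [← div_eq_mul_inv, Rat.num_div_den]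
    have hrt' : (r : ℚ) * m + t * (x : ℚ).den = 1 := by exact_mod_cast hrt
    push_cast
    nth_rewrite 1 [h1]
    field_simp
    linear_combination (-((x : ℚ).num : ℚ)) * hrt'
  have hker : RingHom.ker φ = Ideal.span {(m : ℤ)} := by
    ext k
    rw [RingHom.mem_ker, hφmk, Ideal.Quotient.eq_zero_iff_mem, Ideal.mem_span_singleton,
      Ideal.mem_span_singleton]
    constructor
    · rintro ⟨x, hx⟩
      have hx' : (k : ℚ) = m * x := by
        have := congrArg (Subtype.val : sIntegers S → ℚ) hx
        push_cast at this
        exact this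
      have hk : k * (x : ℚ).den = m * (x : ℚ).num := by
        have : (k : ℚ) * (x : ℚ).den = m * (x : ℚ).num := by
          rw [hx', mul_assoc, Rat.mul_den_eq_num]
        exact_mod_cast this
      exact (Nat.isCoprime_iff_coprime.2 (hcop x)).dvd_of_dvd_mul_right ⟨_, hk⟩
    · rintro ⟨j, rfl⟩
      exact ⟨j, by push_cast; rfl⟩
  rw [← Nat.card_congr (RingHom.quotientKerEquivOfSurjective hsurj).toEquiv, hker,
    Nat.card_congr (Int.quotientSpanNatEquivZMod m).toEquiv, Nat.card_zmod]

end SIntegers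

theorem padicNorm_natCast_pow_self (q : ℕ) [hq : Fact q.Prime] (k : ℕ) :
    padicNorm q ((q : ℚ) ^ k) = ((q : ℚ) ^ k)⁻¹ := by
  induction k with
  | zero => simp
  | succ k ih =>
    rw [pow_succ, padicNorm.mul, ih, padicNorm.padicNorm_p hq.out.one_lt, mul_inv]

/-- Splitting off the part of `N` supported on a finite set of primes. -/
theorem exists_eq_mul_prod_padicNorm (A : Finset ℕ) (hA : ∀ p ∈ A, p.Prime) {N : ℕ} (hN : N ≠ 0) :
    ∃ s m : ℕ, N = s * m ∧ (∀ p : ℕ, p.Prime → p ∣ s → p ∈ A) ∧ (∀ p ∈ A, ¬ p ∣ m) ∧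
      ∏ p ∈ A, padicNorm p N = (s : ℚ)⁻¹ := by
  induction A using Finset.induction_on with
  | empty =>
    exact ⟨1, N, (one_mul N).symm, fun p hp h => absurd (Nat.dvd_one.1 h) hp.ne_one, by simp,
      by simp⟩
  | insert q A hq ih =>
    obtain ⟨s, m, rfl, hs, hm, hprod⟩ := ih fun p hp => hA p (Finset.mem_insert_of_mem hp)
    have hqp := hA q (Finset.mem_insert_self q A)
    have : Fact q.Prime := ⟨hqp⟩
    have hm0 : m ≠ 0 := fun h => hN (by simp [h])
    obtain ⟨k, m', hm', rfl⟩ := Nat.exists_eq_pow_mul_and_not_dvd hm0 q hqp.ne_one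
    have hqs : ¬ q ∣ s := fun h => hq (hs q hqp h)
    refine ⟨s * q ^ k, m', by ring, ?_, ?_, ?_⟩
    · intro p hp h
      rcases hp.dvd_mul.1 h with h | h
      · exact Finset.mem_insert_of_mem (hs p hp h)
      · rw [(Nat.prime_dvd_prime_iff_eq hp hqp).1 (hp.dvd_of_dvd_pow h)]
        exact Finset.mem_insert_self q A
    · intro p hp h
      rcases Finset.mem_insert.1 hp with rfl | hp
      · exact hm' h
      · exact hm p hp (dvd_mul_of_dvd_right h _)
    · have h1 : padicNorm q ((s * (q ^ k * m') : ℕ) : ℚ) = ((q : ℚ) ^ k)⁻¹ := by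
        rw [Nat.cast_mul, Nat.cast_mul, padicNorm.mul, padicNorm.mul,
          (padicNorm.nat_eq_one_iff s).2 hqs, (padicNorm.nat_eq_one_iff m').2 hm', one_mul, mul_one,
          Nat.cast_pow, padicNorm_natCast_pow_self]
      rw [Finset.prod_insert hq, hprod, h1]
      push_cast
      rw [mul_inv, mul_comm]

/-! ### Characters of `R_S` and periodic points of the `S`-integer map -/

section Characters

theorem natCard_addChar_circle (G : Type*) [AddCommGroup G] [Finite G] :
    Nat.card (AddChar G Circle) = Nat.card G := by
  have := Fintype.ofFinite G
  rw [Nat.card_congr (AddChar.circleEquivComplex (α := G)).toEquiv, Nat.card_eq_fintype_card,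
    Nat.card_eq_fintype_card, AddChar.card_eq]

/-- Characters trivial on `I` are exactly the pullbacks from `R ⧸ I`. -/
theorem ncard_addChar_trivial_on {R : Type*} [CommRing R] (I : Ideal R) :
    {ψ : AddChar R Circle | ∀ x ∈ I, ψ x = 1}.ncard = Nat.card (AddChar (R ⧸ I) Circle) := by
  set F : AddChar (R ⧸ I) Circle → AddChar R Circle :=
    fun ψ => ψ.compAddMonoidHom (Ideal.Quotient.mk I).toAddMonoidHom with hF
  have hFapp : ∀ ψ x, F ψ x = ψ (Ideal.Quotient.mk I x) := fun _ _ => rfl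
  have hinj : Function.Injective F := by
    intro ψ ψ' h
    ext y
    obtain ⟨x, rfl⟩ := Ideal.Quotient.mk_surjective y
    rw [← hFapp, ← hFapp, h]
  have hrange : {ψ : AddChar R Circle | ∀ x ∈ I, ψ x = 1} = Set.range F := by
    ext ψ
    constructor
    · intro hψ
      have hker : ∀ x ∈ I.toAddSubgroup, ψ.toAddMonoidHom x = 0 := fun x hx => hψ x hx
      refine ⟨AddChar.toAddMonoidHomEquiv.symm
        (QuotientAddGroup.lift I.toAddSubgroup ψ.toAddMonoidHom hker), ?_⟩
      ext x
      rfl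
    · rintro ⟨ψ, rfl⟩ x hx
      rw [hFapp, Ideal.Quotient.eq_zero_iff_mem.2 hx, AddChar.map_zero_eq_one]
  rw [hrange, ← Set.image_univ, Set.ncard_image_of_injective _ hinj, Set.ncard_univ]

variable {S : Set Nat.Primes}

/-- Characters of the discrete group `R_S` as additive characters. -/
noncomputable def dualEquivAddChar (S : Set Nat.Primes) :
    PontryaginDual (SIntegerGroup S) ≃ AddChar (sIntegers S) Circle where
  toFun χ :=
    { toFun := fun x => χ (Multiplicative.ofAdd x : Multiplicative (sIntegers S))
      map_zero_eq_one' := map_one χ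
      map_add_eq_mul' := fun _ _ => map_mul χ _ _ }
  invFun ψ :=
    { toFun := fun x => ψ (Multiplicative.toAdd (x : Multiplicative (sIntegers S)))
      map_one' := ψ.map_zero_eq_one
      map_mul' := fun _ _ => ψ.map_add_eq_mul _ _
      continuous_toFun := continuous_of_discreteTopology }
  left_inv _ := rfl
  right_inv _ := rfl

theorem dualEquivAddChar_iterate (ξ : sIntegers S) (n : ℕ) (χ : PontryaginDual (SIntegerGroup S))
    (x : sIntegers S) :
    dualEquivAddChar S ((sIntegerMap S ξ)^[n] χ) x = dualEquivAddChar S χ (ξ ^ n * x) := by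
  induction n generalizing χ with
  | zero => simp
  | succ n ih =>
    rw [Function.iterate_succ_apply, ih, pow_succ', mul_assoc]
    rfl

theorem sIntegerMap_iterate_eq_self_iff (ξ : sIntegers S) (n : ℕ)
    (χ : PontryaginDual (SIntegerGroup S)) :
    (sIntegerMap S ξ)^[n] χ = χ ↔
      ∀ x ∈ Ideal.span {ξ ^ n - 1}, dualEquivAddChar S χ x = 1 := by
  rw [← (dualEquivAddChar S).apply_eq_iff_eq, DFunLike.ext_iff]
  simp only [dualEquivAddChar_iterate, Ideal.mem_span_singleton']
  constructor
  · rintro h _ ⟨x, rfl⟩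
    rw [mul_sub, mul_one, AddChar.map_sub_eq_div, mul_comm, h, div_self']
  · intro h x
    have := h _ ⟨x, rfl⟩
    rwa [mul_sub, mul_one, AddChar.map_sub_eq_div, div_eq_one, mul_comm] at this

theorem ncard_sIntegerMap_iterate_eq_self (ξ : sIntegers S) (n : ℕ)
    [Finite (sIntegers S ⧸ Ideal.span {ξ ^ n - 1})] :
    {χ | (sIntegerMap S ξ)^[n] χ = χ}.ncard =
      Nat.card (sIntegers S ⧸ Ideal.span {ξ ^ n - 1}) := by
  rw [← natCard_addChar_circle, ← ncard_addChar_trivial_on,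
    ← Set.ncard_image_of_injective _ (dualEquivAddChar S).injective]
  congr 1
  ext ψ
  simp only [Set.mem_image, Set.mem_ofPred_eq, sIntegerMap_iterate_eq_self_iff]
  constructor
  · rintro ⟨χ, h, rfl⟩
    exact h
  · intro h
    exact ⟨(dualEquivAddChar S).symm ψ, by simpa using h, by simp⟩

/-- The number of points of period `n` of the `S`-integer map. -/
theorem ncard_periodic_sIntegerMap (ξ : sIntegers S) {A : Finset ℕ}
    (hA : ∀ p : ℕ, p ∈ A ↔ ∃ q ∈ S, (q : ℕ) = p) (n : ℕ)
    (hn : (ξ : ℚ).num ^ n - ((ξ : ℚ).den : ℤ) ^ n ≠ 0) :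
    {χ | (sIntegerMap S ξ)^[n] χ = χ}.Finite ∧
    (({χ | (sIntegerMap S ξ)^[n] χ = χ}.ncard : ℕ) : ℚ) =
      |(((ξ : ℚ).num ^ n - ((ξ : ℚ).den : ℤ) ^ n : ℤ) : ℚ)| *
        ∏ p ∈ A, padicNorm p (((ξ : ℚ).num ^ n - ((ξ : ℚ).den : ℤ) ^ n : ℤ) : ℚ) := by
  set D : ℤ := (ξ : ℚ).num ^ n - ((ξ : ℚ).den : ℤ) ^ n with hD
  have hAp : ∀ p ∈ A, p.Prime := fun p hp => by
    obtain ⟨q, -, rfl⟩ := (hA p).1 hp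
    exact q.2
  have hD0 : D.natAbs ≠ 0 := Int.natAbs_ne_zero.2 hn
  -- The `S`-part `s` of `|D|` and the denominator of `ξ` are units of `R_S`, so `ξ ^ n - 1`
  -- generates the same ideal as `m`, whose index is `m = |D| / s`.
  obtain ⟨s, m, hsm, hs, hm, hprod⟩ := exists_eq_mul_prod_padicNorm A hAp hD0
  have hs0 : s ≠ 0 := fun h => hD0 (by simp [hsm, h])
  have hm0 : m ≠ 0 := fun h => hD0 (by simp [hsm, h])
  have hus : IsUnit (s : sIntegers S) := isUnit_natCast_sIntegers hs0 fun p hp => by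
    obtain ⟨q, hq, hqp⟩ := (hA p).1 (hs p p.2 hp)
    rwa [← Subtype.ext hqp]
  have hub : IsUnit ((ξ : ℚ).den : sIntegers S) :=
    isUnit_natCast_sIntegers (ξ : ℚ).den_ne_zero fun p hp => mem_of_dvd_den ξ.2 hp
  have h1 : (ξ ^ n - 1) * ((ξ : ℚ).den : sIntegers S) ^ n = (D : sIntegers S) := by
    refine Subtype.ext ?_
    push_cast [hD]
    rw [sub_mul, one_mul, ← mul_pow, Rat.mul_den_eq_num]
  have h2 : Associated (ξ ^ n - 1) (m : sIntegers S) := by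
    have e1 : Associated (ξ ^ n - 1) (D : sIntegers S) :=
      h1 ▸ (associated_mul_unit_right (ξ ^ n - 1) _ (hub.pow n))
    have e2 : Associated (D : sIntegers S) ((D.natAbs : ℤ) : sIntegers S) :=
      (Int.associated_natAbs D).map (Int.castRingHom (sIntegers S))
    have e3 : Associated (m : sIntegers S) ((D.natAbs : ℤ) : sIntegers S) := by
      rw [hsm]
      push_cast
      exact associated_unit_mul_right _ _ hus
    exact e1.trans (e2.trans e3.symm)
  have hcard : Nat.card (sIntegers S ⧸ Ideal.span {ξ ^ n - 1}) = m := by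
    rw [Ideal.span_singleton_eq_span_singleton.2 h2]
    exact natCard_sIntegers_quotient fun p hp => hm p ((hA p).2 ⟨p, hp, rfl⟩)
  have hfin : Finite (sIntegers S ⧸ Ideal.span {ξ ^ n - 1}) :=
    Nat.finite_of_card_ne_zero (hcard ▸ hm0)
  have hF := ncard_sIntegerMap_iterate_eq_self ξ n
  rw [hcard] at hF
  refine ⟨Set.finite_of_ncard_ne_zero (hF ▸ hm0), ?_⟩
  have habs : |(D : ℚ)| = (D.natAbs : ℚ) := by
    rw [Nat.cast_natAbs, Int.cast_abs]
  have hnorm : ∏ p ∈ A, padicNorm p (D : ℚ) = (s : ℚ)⁻¹ := by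
    rw [← hprod, ← habs]
    refine Finset.prod_congr rfl fun p _ => ?_
    rcases abs_choice (D : ℚ) with h | h <;> rw [h]
    rw [padicNorm.neg]
  rw [hF, hnorm, habs, hsm]
  push_cast
  field_simp

end Characters

/-! ### Chords of the unit circle -/

section Circle

open Real

theorem dist_fourierChar (x y : ℝ) : dist (fourierChar x) (fourierChar y) = 2 * |Real.sin (π * (x - y))| := by
  have h1 : dist (fourierChar x) (fourierChar y) = ‖((fourierChar x : Circle) : ℂ) - fourierChar y‖ := by
    rw [← dist_eq_norm]
    rfl
  have h2 : ((fourierChar x : Circle) : ℂ) - fourierChar y = (((fourierChar (x - y) : Circle) : ℂ) - 1) * fourierChar y := by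
    rw [sub_mul, one_mul, ← Circle.coe_mul, ← AddChar.map_add_eq_mul, sub_add_cancel]
  have h3 : ((fourierChar (x - y) : Circle) : ℂ) = Complex.exp (Complex.I * ((2 * π * (x - y) : ℝ) : ℂ)) := by
    rw [Real.fourierChar_apply, mul_comm]
  rw [h1, h2, norm_mul, Circle.norm_coe, mul_one, h3, Complex.norm_exp_I_mul_ofReal_sub_one,
    norm_mul, Real.norm_eq_abs, Real.norm_eq_abs, abs_two]
  congr 3
  ring

theorem dist_fourierChar_le (x y : ℝ) : dist (fourierChar x) (fourierChar y) ≤ 2 * π * |x - y| := by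
  rw [dist_fourierChar, mul_assoc]
  refine mul_le_mul_of_nonneg_left (abs_sin_le_abs.trans_eq ?_) zero_le_two
  rw [abs_mul, abs_of_pos pi_pos]

theorem four_mul_abs_sub_round_le_dist (x y : ℝ) :
    4 * |x - y - round (x - y)| ≤ dist (fourierChar x) (fourierChar y) := by
  set z : ℤ := round (x - y) with hz
  have h1 : dist (fourierChar x) (fourierChar y) = 2 * |Real.sin (π * (x - y - z))| := by
    have e : π * (x - y - z) = π * (x - y) - z * π := by ring
    rw [dist_fourierChar, e, Real.sin_sub_int_mul_pi, abs_mul, abs_zpow, abs_neg, abs_one, one_zpow, one_mul]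
  have h2 : |x - y - z| ≤ 1 / 2 := abs_sub_round _
  have h3 : |π * (x - y - z)| ≤ π / 2 := by
    rw [abs_mul, abs_of_pos pi_pos]
    nlinarith [pi_pos]
  have h4 := mul_abs_le_abs_sin h3
  rw [abs_mul, abs_of_pos pi_pos, ← mul_assoc, div_mul_cancel₀ _ pi_ne_zero] at h4
  rw [h1]
  linarith

theorem exists_fourierChar_eq (z : Circle) : ∃ α : ℝ, |α| ≤ 1 ∧ fourierChar α = z := by
  refine ⟨Complex.arg z / (2 * π), ?_, ?_⟩
  · rw [abs_div, abs_of_pos (by positivity : (0 : ℝ) < 2 * π), div_le_one (by positivity)]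
    linarith [Complex.abs_arg_le_pi (z : ℂ), pi_pos]
  · rw [Real.fourierChar_apply', mul_div_cancel₀ _ (by positivity : 2 * π ≠ 0), Circle.exp_arg]

end Circle

/-- If `a ^ i b ^ (n - i) Δ` is close to an integer for all `i ≤ n`, then `Δ` is very close to
an integer. -/
theorem exists_int_near_of_forall_pow_near {a b : ℤ} (hab : IsCoprime a b) (hb : b ≠ 0) {ε Δ : ℝ}
    (hε : ε * (|(a : ℝ)| + |(b : ℝ)|) ≤ 1) {n : ℕ}
    (h : ∀ i ≤ n, ∃ z : ℤ, |(a : ℝ) ^ i * (b : ℝ) ^ (n - i) * Δ - z| < ε) :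
    ∃ z : ℤ, |(a : ℝ)| ^ n * |Δ - z| < ε ∧ |(b : ℝ)| ^ n * |Δ - z| < ε := by
  choose! z hz using h
  -- The two sides are integers differing by less than `ε (|a| + |b|) ≤ 1`. Iterating gives `b ^ n
  -- z_n = a ^ n z_0`, and coprimality then yields `z_0 = b ^ n w`, `z_n = a ^ n w`.
  have hstep : ∀ i < n, a * z i = b * z (i + 1) := by
    intro i hi
    have h1 := hz i hi.le
    have h2 := hz (i + 1) hi
    set r := (a : ℝ) ^ i * (b : ℝ) ^ (n - i) * Δ - z i with hr
    set r' := (a : ℝ) ^ (i + 1) * (b : ℝ) ^ (n - (i + 1)) * Δ - z (i + 1) with hr'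
    have h3 : ((a * z i - b * z (i + 1) : ℤ) : ℝ) = b * r' - a * r := by
      have : n - i = n - (i + 1) + 1 := by omega
      rw [hr, hr', this]
      push_cast
      ring
    have hb' : 0 < |(b : ℝ)| := abs_pos.2 (by exact_mod_cast hb)
    have h4 : |((a * z i - b * z (i + 1) : ℤ) : ℝ)| < 1 := by
      rw [h3]
      refine (abs_sub _ _).trans_lt ?_
      rw [abs_mul, abs_mul]
      nlinarith [abs_nonneg (a : ℝ), mul_lt_mul_of_pos_left h2 hb',
        mul_le_mul_of_nonneg_left h1.le (abs_nonneg (a : ℝ))]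
    have h5 : |a * z i - b * z (i + 1)| < 1 := by exact_mod_cast h4
    rw [Int.abs_lt_one_iff] at h5
    omega
  have hpow : ∀ i ≤ n, b ^ i * z i = a ^ i * z 0 := by
    intro i
    induction i with
    | zero => simp
    | succ i ih =>
      intro hi
      rw [pow_succ, pow_succ, mul_assoc, ← hstep i hi, mul_right_comm (a ^ i), ← ih (by omega)]
      ring
  have hcop : IsCoprime (b ^ n) (a ^ n) := (hab.pow).symm
  obtain ⟨w, hw⟩ := hcop.dvd_of_dvd_mul_left ⟨z n, (hpow n le_rfl).symm⟩
  have hwn : z n = a ^ n * w := by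
    have := hpow n le_rfl
    rw [hw] at this
    exact mul_left_cancel₀ (pow_ne_zero n hb) (by linear_combination this)
  refine ⟨w, ?_, ?_⟩
  · have := hz n le_rfl
    rw [hwn] at this
    have e : (a : ℝ) ^ n * (b : ℝ) ^ (n - n) * Δ - ((a ^ n * w : ℤ) : ℝ) =
        (a : ℝ) ^ n * (Δ - w) := by
      rw [Nat.sub_self]
      push_cast
      ring
    rwa [e, abs_mul, abs_pow] at this
  · have := hz 0 (Nat.zero_le n)
    rw [hw] at this
    have e : (a : ℝ) ^ 0 * (b : ℝ) ^ (n - 0) * Δ - ((b ^ n * w : ℤ) : ℝ) =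
        (b : ℝ) ^ n * (Δ - w) := by
      rw [Nat.sub_zero]
      push_cast
      ring
    rwa [e, abs_mul, abs_pow] at this

/-! ### The uniform structure of the character group -/

section Entropy

open Topology Uniformity

variable {S : Set Nat.Primes}

theorem continuous_dualEquivAddChar_apply (x : sIntegers S) :
    Continuous fun χ : PontryaginDual (SIntegerGroup S) => dualEquivAddChar S χ x :=
  (ContinuousEvalConst.continuous_eval_const (F := SIntegerGroup S →ₜ* Circle)
    (Multiplicative.ofAdd x : Multiplicative (sIntegers S)))

theorem mem_uniformity_dual (x : sIntegers S) {δ : ℝ} (hδ : 0 < δ) :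
    {p : PontryaginDual (SIntegerGroup S) × PontryaginDual (SIntegerGroup S) |
      dist (dualEquivAddChar S p.1 x) (dualEquivAddChar S p.2 x) < δ} ∈
      (uniformSpaceOfCompactR1 : UniformSpace (PontryaginDual (SIntegerGroup S))).uniformity := by
  change _ ∈ 𝓝ˢ (Set.diagonal _)
  refine IsOpen.mem_nhdsSet (isOpen_lt ?_ continuous_const) |>.2 ?_
  · exact ((continuous_dualEquivAddChar_apply x).comp continuous_fst).dist
      ((continuous_dualEquivAddChar_apply x).comp continuous_snd)
  · rintro ⟨χ, ψ⟩ h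
    obtain rfl : χ = ψ := h
    simpa using hδ

/-- Evaluation embeds the compact dual into a product of circles, and a compact Hausdorff space has
a unique compatible uniformity, so this one is that of pointwise convergence. -/
theorem exists_finset_of_mem_uniformity_dual
    {U : Set (PontryaginDual (SIntegerGroup S) × PontryaginDual (SIntegerGroup S))}
    (hU : U ∈ (uniformSpaceOfCompactR1 :
      UniformSpace (PontryaginDual (SIntegerGroup S))).uniformity) :
    ∃ (F : Finset (sIntegers S)) (ε : ℝ), 0 < ε ∧ ∀ χ ψ : PontryaginDual (SIntegerGroup S),
      (∀ x ∈ F, dist (dualEquivAddChar S χ x) (dualEquivAddChar S ψ x) < ε) → (χ, ψ) ∈ U := by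
  set ev : PontryaginDual (SIntegerGroup S) → sIntegers S → Circle :=
    fun χ x => dualEquivAddChar S χ x with hev
  have hcont : Continuous ev := continuous_pi continuous_dualEquivAddChar_apply
  have hinj : Function.Injective ev := fun χ ψ h =>
    (dualEquivAddChar S).injective (DFunLike.coe_injective h)
  have hemb := hcont.isClosedEmbedding hinj
  set u : UniformSpace (PontryaginDual (SIntegerGroup S)) :=
    UniformSpace.comap ev inferInstance with hu
  have huniq : uniformSpaceOfCompactR1 = u :=
    unique_uniformity_of_compact rfl hemb.isInducing.eq_induced.symm
  rw [huniq] at hU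
  replace hU : U ∈ Filter.comap (Prod.map ev ev) (𝓤 (sIntegers S → Circle)) := hU
  rw [Pi.uniformity, Filter.comap_iInf] at hU
  simp only [Filter.comap_comap] at hU
  obtain ⟨⟨I, f⟩, ⟨hI, hf⟩, hfU⟩ := (Filter.HasBasis.iInf' fun x : sIntegers S =>
    (Metric.uniformity_basis_dist (α := Circle)).comap _).mem_iff.1 hU
  have hev : ∀ᶠ ε : ℝ in 𝓝[>] 0, ∀ x ∈ I, ε < f x :=
    (Filter.eventually_all_finite hI).2 fun x hx =>
      Filter.Eventually.filter_mono nhdsWithin_le_nhds (eventually_lt_nhds (hf x hx))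
  obtain ⟨ε, hε, hε0⟩ := (hev.and self_mem_nhdsWithin).exists
  refine ⟨hI.toFinset, ε, hε0, fun χ ψ h => hfU ?_⟩
  simp only [Set.mem_iInter]
  intro x hx
  exact (h x (hI.mem_toFinset.2 hx)).trans (hε x hx)

/-- The character `x ↦ exp (2 π i t x)` of `R_S`. -/
noncomputable def realChar (S : Set Nat.Primes) (t : ℝ) : PontryaginDual (SIntegerGroup S) :=
  (dualEquivAddChar S).symm
    (Real.fourierChar.compAddMonoidHom
      { toFun := fun x : sIntegers S => t * ((x : ℚ) : ℝ)
        map_zero' := by simp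
        map_add' := fun x y => by push_cast; ring })

theorem dualEquivAddChar_realChar (t : ℝ) (x : sIntegers S) :
    dualEquivAddChar S (realChar S t) x = Real.fourierChar (t * ((x : ℚ) : ℝ)) := rfl

/-! ### Entropy of the `S`-integer map -/

/-- The exponential of the entropy of the `S`-integer map given by `ξ`. -/
def ratHeight (ξ : ℚ) : ℕ := max ξ.num.natAbs ξ.den

theorem ratHeight_pos (ξ : ℚ) : 0 < ratHeight ξ := lt_max_of_lt_right ξ.den_pos

theorem natAbs_pow_mul_pow_le (ξ : ℚ) {i n : ℕ} (hi : i ≤ n) :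
    |((ξ.num : ℝ) ^ i * (ξ.den : ℝ) ^ (n - i))| ≤ (ratHeight ξ : ℝ) ^ n := by
  have h1 : |(ξ.num : ℝ)| ≤ ratHeight ξ := by
    rw [← Int.cast_abs, ← Nat.cast_natAbs]
    exact_mod_cast le_max_left _ _
  have h2 : (ξ.den : ℝ) ≤ ratHeight ξ := by exact_mod_cast le_max_right _ _
  rw [abs_mul, abs_pow, abs_pow, Nat.abs_cast, ← Nat.add_sub_of_le hi, pow_add,
    Nat.add_sub_cancel_left]
  gcongr

/-- For `x ∈ F` and `i ≤ n`, every `ξ ^ i x` is an integer multiple, of size `O(M ^ n)`, of the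
single element `y = 1 / (q b ^ n)`. Hence knowing `χ y` to precision of order `M ^ (-n)` controls
the orbit of `χ` up to time `n`, and `O(M ^ n)` grid points suffice. -/
theorem coverEntropyEntourage_sIntegerMap_le (ξ : sIntegers S)
    {U : Set (PontryaginDual (SIntegerGroup S) × PontryaginDual (SIntegerGroup S))}
    (hU : U ∈ (uniformSpaceOfCompactR1 :
      UniformSpace (PontryaginDual (SIntegerGroup S))).uniformity) :
    Dynamics.coverEntropyEntourage (sIntegerMap S ξ) Set.univ U ≤
      ENNReal.log (ratHeight (ξ : ℚ)) := by
  classical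
  obtain ⟨F, ε, hε, hFU⟩ := exists_finset_of_mem_uniformity_dual hU
  set M := ratHeight (ξ : ℚ) with hM
  have hM1 : 1 ≤ M := ratHeight_pos _
  set a := (ξ : ℚ).num with ha
  set b := (ξ : ℚ).den with hb
  have hb0 : b ≠ 0 := (ξ : ℚ).den_ne_zero
  have hbS : ∀ p : Nat.Primes, (p : ℕ) ∣ b → p ∈ S := fun p hp => mem_of_dvd_den ξ.2 hp
  -- a common denominator of `F`
  set q : ℕ := ∏ x ∈ F, (x : ℚ).den with hq
  have hq0 : q ≠ 0 := Finset.prod_ne_zero_iff.2 fun x _ => (x : ℚ).den_ne_zero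
  have hqS : ∀ p : Nat.Primes, (p : ℕ) ∣ q → p ∈ S := fun p hp => by
    obtain ⟨x, -, hx⟩ := (p.2.prime.dvd_finsetProd_iff _).1 hp
    exact mem_of_dvd_den x.2 hx
  have hj : ∀ x : sIntegers S, ∃ j : ℤ, x ∈ F → (x : ℚ) * q = j := by
    intro x
    by_cases hx : x ∈ F
    · obtain ⟨c, hc⟩ := Finset.dvd_prod_of_mem (fun x : sIntegers S => (x : ℚ).den) hx
      refine ⟨(x : ℚ).num * c, fun _ => ?_⟩
      rw [hq, hc]
      push_cast
      rw [← mul_assoc, Rat.mul_den_eq_num]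
    · exact ⟨0, fun h => absurd h hx⟩
  choose j hj using hj
  set J : ℝ := ∑ x ∈ F, |(j x : ℝ)| + 1 with hJ
  have hJ1 : 1 ≤ J := le_add_of_nonneg_left (Finset.sum_nonneg fun _ _ => abs_nonneg _)
  have hjJ : ∀ x ∈ F, |(j x : ℝ)| ≤ J := fun x hx =>
    (Finset.single_le_sum (f := fun x => |(j x : ℝ)|) (fun _ _ => abs_nonneg _) hx).trans
      (le_add_of_nonneg_right zero_le_one)
  -- the size of the grid
  set c : ℝ := 2 * Real.pi * J / ε + 1 with hc
  have hc0 : 0 < c := by positivity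
  have hcover : ∀ n : ℕ, Dynamics.coverMincard (sIntegerMap S ξ) Set.univ U n ≤
      ((2 * (⌈c⌉₊ * M ^ n) + 1 : ℕ) : ℕ∞) := by
    intro n
    have hMn : (0 : ℝ) < (M : ℝ) ^ n := by
      have : (0 : ℝ) < M := by exact_mod_cast hM1
      positivity
    set K : ℕ := ⌈c⌉₊ * M ^ n with hK
    have hK0 : (0 : ℝ) < K := by
      have : (0 : ℝ) < (⌈c⌉₊ : ℝ) := hc0.trans_le (Nat.le_ceil c)
      rw [hK]
      push_cast
      positivity
    have hKc : c * (M : ℝ) ^ n ≤ K := by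
      rw [hK]
      push_cast
      exact mul_le_mul_of_nonneg_right (Nat.le_ceil c) hMn.le
    have hyS : ((q * b ^ n : ℕ) : ℚ)⁻¹ ∈ sIntegers S := inv_natCast_mem_sIntegers fun p hp => by
      rcases p.2.dvd_mul.1 hp with h | h
      · exact hqS p h
      · exact hbS p (p.2.dvd_of_dvd_pow h)
    set y : sIntegers S := ⟨_, hyS⟩
    have hyv : (y : ℚ) = ((q * b ^ n : ℕ) : ℚ)⁻¹ := rfl
    have hqb : ((q * b ^ n : ℕ) : ℚ) ≠ 0 := by
      exact_mod_cast mul_ne_zero hq0 (pow_ne_zero n hb0)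
    have hmul : ∀ x ∈ F, ∀ i ≤ n, ξ ^ i * x = (a ^ i * (b : ℤ) ^ (n - i) * j x) • y := by
      intro x hx i hi
      refine Subtype.ext ?_
      rw [zsmul_eq_mul]
      push_cast
      rw [hyv, eq_mul_inv_iff_mul_eq₀ hqb, ← hj x hx]
      have hab : (ξ : ℚ) * b = a := Rat.mul_den_eq_num _
      have hbn : (b : ℚ) ^ n = b ^ i * b ^ (n - i) := by rw [← pow_add, Nat.add_sub_of_le hi]
      rw [← hab]
      push_cast
      rw [hbn]
      ring
    have hclose : ∀ (χ ψ : PontryaginDual (SIntegerGroup S)) (α β : ℝ),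
        Real.fourierChar α = dualEquivAddChar S χ y → Real.fourierChar β = dualEquivAddChar S ψ y →
        |α - β| ≤ 1 / K → (χ, ψ) ∈ Dynamics.dynEntourage (sIntegerMap S ξ) U n := by
      intro χ ψ α β hα hβ hαβ
      rw [Dynamics.mem_dynEntourage]
      intro i hi
      refine hFU _ _ fun x hx => ?_
      rw [dualEquivAddChar_iterate, dualEquivAddChar_iterate, hmul x hx i hi.le,
        AddChar.map_zsmul_eq_zpow, AddChar.map_zsmul_eq_zpow, ← hα, ← hβ,
        ← AddChar.map_zsmul_eq_zpow, ← AddChar.map_zsmul_eq_zpow]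
      refine (dist_fourierChar_le _ _).trans_lt ?_
      rw [zsmul_eq_mul, zsmul_eq_mul, ← mul_sub, abs_mul]
      have h1 : |((a ^ i * (b : ℤ) ^ (n - i) * j x : ℤ) : ℝ)| ≤ (M : ℝ) ^ n * J := by
        push_cast
        rw [abs_mul]
        exact mul_le_mul (natAbs_pow_mul_pow_le _ hi.le) (hjJ x hx) (abs_nonneg _) hMn.le
      calc 2 * Real.pi * (|((a ^ i * (b : ℤ) ^ (n - i) * j x : ℤ) : ℝ)| * |α - β|)
          ≤ 2 * Real.pi * (((M : ℝ) ^ n * J) * (1 / K)) := by gcongr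
        _ < ε := by
          rw [mul_one_div, ← mul_div_assoc, div_lt_iff₀ hK0]
          have h2 : 2 * Real.pi * J < c * ε := by
            rw [hc, add_mul, one_mul, div_mul_cancel₀ _ hε.ne']
            linarith
          calc _ = 2 * Real.pi * J * (M : ℝ) ^ n := by ring
            _ < c * ε * (M : ℝ) ^ n := mul_lt_mul_of_pos_right h2 hMn
            _ = ε * (c * (M : ℝ) ^ n) := by ring
            _ ≤ ε * K := mul_le_mul_of_nonneg_left hKc hε.le
    -- Real characters whose values at `y` are `exp (2 π i k / K)`.
    set pt : ℤ → PontryaginDual (SIntegerGroup S) :=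
      fun k => realChar S ((k : ℝ) / K * ((q * b ^ n : ℕ) : ℝ)) with hpt
    have hpty : ∀ k : ℤ, Real.fourierChar ((k : ℝ) / K) = dualEquivAddChar S (pt k) y := by
      intro k
      rw [hpt, dualEquivAddChar_realChar, hyv, Rat.cast_inv, Rat.cast_natCast,
        mul_inv_cancel_right₀ (by exact_mod_cast hqb)]
    have hdyn : Dynamics.IsDynCoverOf (sIntegerMap S ξ) Set.univ U n
        (((Finset.Icc (-(K : ℤ)) K).image pt : Finset _) : Set _) := by
      intro χ _
      obtain ⟨α, hα1, hα⟩ := exists_fourierChar_eq (dualEquivAddChar S χ y)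
      have hαK : |α * K| ≤ K := by
        rw [abs_mul, abs_of_pos hK0]
        exact mul_le_of_le_one_left hK0.le hα1
      refine ⟨pt ⌊α * K⌋, ?_, hclose χ _ α _ hα (hpty _) ?_⟩
      · refine Finset.mem_coe.2 (Finset.mem_image_of_mem _ (Finset.mem_Icc.2 ⟨?_, ?_⟩))
        · rw [Int.le_floor]
          push_cast
          exact (abs_le.1 hαK).1
        · have : (⌊α * K⌋ : ℝ) ≤ K := (Int.floor_le _).trans (abs_le.1 hαK).2
          exact_mod_cast this
      · have h1 : α - (⌊α * K⌋ : ℝ) / K = (α * K - ⌊α * K⌋) / K := by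
          field_simp
        rw [h1, abs_div, abs_of_pos hK0]
        gcongr
        rw [abs_of_nonneg (sub_nonneg.2 (Int.floor_le _))]
        linarith [Int.lt_floor_add_one (α * K)]
    refine hdyn.coverMincard_le_card.trans ?_
    have : ((Finset.Icc (-(K : ℤ)) K).image pt).card ≤ 2 * K + 1 := by
      refine Finset.card_image_le.trans ?_
      rw [Int.card_Icc]
      omega
    exact_mod_cast this
  rw [Dynamics.coverEntropyEntourage, ← ExpGrowth.expGrowthSup_pow]
  refine ExpGrowth.expGrowthSup_le_of_eventually_le (b := ((2 * ⌈c⌉₊ + 1 : ℕ) : ENNReal))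
    (ENNReal.natCast_ne_top _) (Filter.Eventually.of_forall fun n => ?_)
  refine (ENat.toENNReal_mono (hcover n)).trans ?_
  have : 2 * (⌈c⌉₊ * M ^ n) + 1 ≤ (2 * ⌈c⌉₊ + 1) * M ^ n := by
    have := Nat.one_le_pow n M hM1
    nlinarith
  rw [ENat.toENNReal_coe]
  exact_mod_cast this

/-- The real characters with parameter `k b ^ n / M ^ n`, `0 ≤ k < M ^ n`, are separated by
evaluation at `1`. If the dynamical balls of two of them meet, `exists_int_near_of_forall_pow_near`
puts `(k - l) / M ^ n` within less than `M ^ (-n)` of an integer, which forces `k = l`. Time `n + 1`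
makes all `i ≤ n` available. -/
theorem le_netMaxcard_sIntegerMap (ξ : sIntegers S) :
    ∃ U ∈ (uniformSpaceOfCompactR1 : UniformSpace (PontryaginDual (SIntegerGroup S))).uniformity,
      ∀ n : ℕ, ((ratHeight (ξ : ℚ) ^ n : ℕ) : ℕ∞) ≤
        Dynamics.netMaxcard (sIntegerMap S ξ) Set.univ U (n + 1) := by
  classical
  set M := ratHeight (ξ : ℚ) with hM
  have hM1 : 1 ≤ M := ratHeight_pos _
  set a := (ξ : ℚ).num with ha
  set b : ℤ := ((ξ : ℚ).den : ℤ) with hb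
  have hb0 : b ≠ 0 := Int.natCast_ne_zero.2 (ξ : ℚ).den_ne_zero
  have hbR : (0 : ℝ) < |(b : ℝ)| := abs_pos.2 (by exact_mod_cast hb0)
  have hcop : IsCoprime a b := (ξ : ℚ).isCoprime_num_den
  set ε : ℝ := 1 / (|(a : ℝ)| + |(b : ℝ)|) with hε
  have hε0 : 0 < ε := by positivity
  have hεab : ε * (|(a : ℝ)| + |(b : ℝ)|) ≤ 1 := by
    rw [hε, one_div, inv_mul_cancel₀ (by positivity)]
  have hε1 : ε ≤ 1 := by
    have : (1 : ℝ) ≤ |(b : ℝ)| := by exact_mod_cast Int.one_le_abs hb0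
    rw [hε, div_le_one (by positivity)]
    linarith [abs_nonneg (a : ℝ)]
  refine ⟨_, mem_uniformity_dual (1 : sIntegers S) (δ := ε) hε0, fun n => ?_⟩
  have hMn : (0 : ℝ) < (M : ℝ) ^ n := by
    have : (0 : ℝ) < M := by exact_mod_cast hM1
    positivity
  set pt : ℕ → PontryaginDual (SIntegerGroup S) :=
    fun k => realChar S ((k : ℝ) / (M : ℝ) ^ n * (b : ℝ) ^ n) with hpt
  have hptval : ∀ k i, i ≤ n → dualEquivAddChar S ((sIntegerMap S ξ)^[i] (pt k)) 1 =
      Real.fourierChar ((a : ℝ) ^ i * (b : ℝ) ^ (n - i) * ((k : ℝ) / (M : ℝ) ^ n)) := by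
    intro k i hi
    rw [dualEquivAddChar_iterate, hpt, dualEquivAddChar_realChar, mul_one]
    congr 1
    have hab : (((ξ : ℚ) : ℝ)) * b = a := by
      have : (ξ : ℚ) * (ξ : ℚ).den = (ξ : ℚ).num := Rat.mul_den_eq_num _
      exact_mod_cast this
    have hbn : (b : ℝ) ^ n = b ^ i * b ^ (n - i) := by rw [← pow_add, Nat.add_sub_of_le hi]
    rw [← hab, hbn]
    push_cast
    ring
  have hkey : ∀ k l : ℕ, k < M ^ n → l < M ^ n →
      ∀ χ, χ ∈ UniformSpace.ball (pt k) (Dynamics.dynEntourage (sIntegerMap S ξ)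
        {p | dist (dualEquivAddChar S p.1 1) (dualEquivAddChar S p.2 1) < ε} (n + 1)) →
      χ ∈ UniformSpace.ball (pt l) (Dynamics.dynEntourage (sIntegerMap S ξ)
        {p | dist (dualEquivAddChar S p.1 1) (dualEquivAddChar S p.2 1) < ε} (n + 1)) →
      k = l := by
    intro k l hk hl χ hχk hχl
    have hk' := Dynamics.mem_dynEntourage.1 hχk
    have hl' := Dynamics.mem_dynEntourage.1 hχl
    obtain ⟨z, hz1, hz2⟩ := exists_int_near_of_forall_pow_near hcop hb0 (n := n)
      (Δ := (k : ℝ) / (M : ℝ) ^ n - (l : ℝ) / (M : ℝ) ^ n) hεab (by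
        intro i hi
        have h1 : dist (dualEquivAddChar S ((sIntegerMap S ξ)^[i] (pt k)) 1)
          (dualEquivAddChar S ((sIntegerMap S ξ)^[i] χ) 1) < ε := hk' i (by omega)
        have h2 : dist (dualEquivAddChar S ((sIntegerMap S ξ)^[i] (pt l)) 1)
          (dualEquivAddChar S ((sIntegerMap S ξ)^[i] χ) 1) < ε := hl' i (by omega)
        have h3 := dist_triangle_right (dualEquivAddChar S ((sIntegerMap S ξ)^[i] (pt k)) 1)
          (dualEquivAddChar S ((sIntegerMap S ξ)^[i] (pt l)) 1)
          (dualEquivAddChar S ((sIntegerMap S ξ)^[i] χ) 1)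
        rw [hptval k i hi, hptval l i hi] at h3
        have h4 := four_mul_abs_sub_round_le_dist
          ((a : ℝ) ^ i * (b : ℝ) ^ (n - i) * ((k : ℝ) / (M : ℝ) ^ n))
          ((a : ℝ) ^ i * (b : ℝ) ^ (n - i) * ((l : ℝ) / (M : ℝ) ^ n))
        rw [hptval k i hi] at h1
        rw [hptval l i hi] at h2
        rw [← mul_sub] at h4
        refine ⟨_, lt_of_mul_lt_mul_left (h4.trans_lt ?_) (by norm_num : (0 : ℝ) ≤ 4)⟩
        linarith)
    have hMz : (M : ℝ) ^ n * |(k : ℝ) / (M : ℝ) ^ n - (l : ℝ) / (M : ℝ) ^ n - z| < 1 := by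
      have hMab : (M : ℝ) = |(a : ℝ)| ∨ (M : ℝ) = |(b : ℝ)| := by
        rcases max_choice (ξ : ℚ).num.natAbs (ξ : ℚ).den with h | h
        · left
          rw [hM, ratHeight, h, ha, Nat.cast_natAbs, Int.cast_abs]
        · right
          rw [hM, ratHeight, h, hb, Int.cast_natCast, Nat.abs_cast]
      rcases hMab with h | h
      · rw [← h] at hz1
        linarith
      · rw [← h] at hz2
        linarith
    rw [← abs_of_pos hMn, ← abs_mul, abs_of_pos hMn] at hMz
    have h5 : (M : ℝ) ^ n * ((k : ℝ) / (M : ℝ) ^ n - (l : ℝ) / (M : ℝ) ^ n - z) =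
        (((k : ℤ) - l - (M ^ n : ℕ) * z : ℤ) : ℝ) := by
      push_cast
      field_simp
    rw [h5] at hMz
    have h6 : |(k : ℤ) - l - (M ^ n : ℕ) * z| < 1 := by exact_mod_cast hMz
    rw [Int.abs_lt_one_iff, sub_eq_zero] at h6
    have h7 : |(k : ℤ) - l| < (M ^ n : ℕ) := by
      rw [abs_lt]
      constructor <;> omega
    have h8 := Int.eq_zero_of_abs_lt_dvd ⟨z, h6⟩ h7
    omega
  have hinj : Set.InjOn pt (Finset.range (M ^ n) : Set ℕ) := by
    intro k hk l hl h
    refine hkey k l (Finset.mem_range.1 hk) (Finset.mem_range.1 hl) (pt k) ?_ ?_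
    · exact Dynamics.mem_dynEntourage.2 fun i _ => by simpa using hε0
    · exact Dynamics.mem_dynEntourage.2 fun i _ => by simpa [h] using hε0
  have hnet : Dynamics.IsDynNetIn (sIntegerMap S ξ) Set.univ
      {p | dist (dualEquivAddChar S p.1 1) (dualEquivAddChar S p.2 1) < ε} (n + 1)
      (((Finset.range (M ^ n)).image pt : Finset _) : Set _) := by
    refine ⟨Set.subset_univ _, ?_⟩
    rw [Finset.coe_image]
    rintro _ ⟨k, hk, rfl⟩ _ ⟨l, hl, rfl⟩ hne
    rw [Function.onFun, Set.disjoint_left]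
    intro χ hχk hχl
    exact hne (congrArg pt (hkey k l (Finset.mem_range.1 hk) (Finset.mem_range.1 hl) χ hχk hχl))
  have := hnet.card_le_netMaxcard
  rwa [Finset.card_image_of_injOn hinj, Finset.card_range] at this

theorem topologicalEntropy_sIntegerMap (ξ : sIntegers S) :
    topologicalEntropy (sIntegerMap S ξ) = ((Real.log (ratHeight (ξ : ℚ)) : ℝ) : EReal) := by
  have hM1 : 1 ≤ ratHeight (ξ : ℚ) := ratHeight_pos _
  have hlog : ((Real.log (ratHeight (ξ : ℚ)) : ℝ) : EReal) =
      ENNReal.log (ratHeight (ξ : ℚ)) := by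
    rw [← ENNReal.ofReal_natCast, ENNReal.log_ofReal_of_pos (by exact_mod_cast hM1)]
  rw [hlog, topologicalEntropy]
  let _ : UniformSpace (PontryaginDual (SIntegerGroup S)) := uniformSpaceOfCompactR1
  refine le_antisymm (iSup₂_le fun U hU => coverEntropyEntourage_sIntegerMap_le ξ hU) ?_
  obtain ⟨U, hU, hnet⟩ := le_netMaxcard_sIntegerMap ξ
  refine le_trans ?_ ((Dynamics.netEntropyEntourage_le_coverEntropyEntourage _ _).trans
    (Dynamics.coverEntropyEntourage_le_coverEntropy _ _ hU))
  set M := ratHeight (ξ : ℚ) with hM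
  have hM0 : ((M : ℕ) : ENNReal) ≠ 0 := by exact_mod_cast (by omega : M ≠ 0)
  rw [Dynamics.netEntropyEntourage, ← ExpGrowth.expGrowthSup_pow]
  -- The net at time `n + 1` has only `M ^ n` points; the lost factor `M` does not affect the growth
  -- rate.
  refine ExpGrowth.expGrowthSup_of_eventually_ge (b := ((M : ℕ) : ENNReal)⁻¹)
    (ENNReal.inv_ne_zero.2 (ENNReal.natCast_ne_top _)) ?_
  filter_upwards [Filter.eventually_gt_atTop 0] with n hn
  obtain ⟨m, rfl⟩ := Nat.exists_eq_succ_of_ne_zero hn.ne'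
  rw [pow_succ', ← mul_assoc, ENNReal.inv_mul_cancel hM0 (ENNReal.natCast_ne_top _), one_mul]
  refine le_trans (le_of_eq ?_) (ENat.toENNReal_mono (hnet m))
  rw [ENat.toENNReal_coe]
  push_cast
  rfl

end Entropy

/-! ### Mertens' theorem for `S`-integer maps -/

/-- If `n O(n)` agrees with `F(n) = D(n) f(n)` up to the contribution of the proper divisors of
`n`, and `D(n)` is `M ^ n` up to `m ^ n`, then `O(n) M ^ (-n)` is exponentially close to
`f(n) / n`. -/
theorem abs_div_pow_sub_div_le {M m : ℝ} (hM : 1 < M) (hm : 0 ≤ m) (hmM : m < M) {F O : ℕ → ℕ}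
    {D f : ℕ → ℝ} (hf0 : ∀ n, 0 ≤ f n) (hf1 : ∀ n, f n ≤ 1)
    (hF : ∀ n, 0 < n → (F n : ℝ) = D n * f n) (hD : ∀ n, 0 < n → |D n - M ^ n| ≤ m ^ n)
    (hle : ∀ n, 0 < n → n * O n ≤ F n)
    (hge : ∀ n, 0 < n → F n ≤ n * O n + ∑ d ∈ n.properDivisors, F d) {n : ℕ} (hn : 0 < n) :
    |O n / M ^ n - f n / n| ≤ 3 * (max (1 / √M) (m / M)) ^ n := by
  have hM0 : 0 < M := by linarith
  have hMn : 0 < M ^ n := by positivity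
  have hn0 : (0 : ℝ) < n := by exact_mod_cast hn
  have hF2 : ∀ d, 0 < d → (F d : ℝ) ≤ 2 * M ^ d := by
    intro d hd
    have h1 := (abs_le.1 (hD d hd)).2
    have h2 : m ^ d ≤ M ^ d := by gcongr
    rw [hF d hd]
    rcases le_total 0 (D d) with h | h
    · exact (mul_le_of_le_one_right h (hf1 d)).trans (by linarith)
    · exact (mul_nonpos_of_nonpos_of_nonneg h (hf0 d)).trans (by positivity)
  have hsum : ((∑ d ∈ n.properDivisors, F d : ℕ) : ℝ) ≤ n * (2 * M ^ (n / 2)) := by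
    push_cast
    have hcard : (n.properDivisors.card : ℝ) ≤ n := by
      have : n.properDivisors.card ≤ n := by
        refine (Finset.card_le_card (t := Finset.range n) fun d hd => ?_).trans_eq
          (Finset.card_range n)
        exact Finset.mem_range.2 (Nat.mem_properDivisors.1 hd).2
      exact_mod_cast this
    calc ∑ d ∈ n.properDivisors, (F d : ℝ) ≤ n.properDivisors.card • (2 * M ^ (n / 2)) := by
          refine Finset.sum_le_card_nsmul _ _ _ fun d hd => ?_
          refine (hF2 d (Nat.pos_of_mem_properDivisors hd)).trans ?_
          have hd2 : d ≤ n / 2 := by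
            obtain ⟨⟨e, rfl⟩, hlt⟩ := Nat.mem_properDivisors.1 hd
            have he : 2 ≤ e := by
              by_contra h
              have : e ≤ 1 := by omega
              nlinarith
            rw [Nat.le_div_iff_mul_le two_pos]
            exact Nat.mul_le_mul_left d he
          have := pow_le_pow_right₀ hM.le hd2
          linarith
      _ ≤ n * (2 * M ^ (n / 2)) := by
          rw [nsmul_eq_mul]
          gcongr
  -- `1 / √M` comes from the proper divisors, all at most `n / 2`; `m / M` comes from replacing `D
  -- n` by `M ^ n`.
  set r := max (1 / √M) (m / M) with hr
  have hsq : 0 < √M := Real.sqrt_pos.2 hM0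
  have h1 : |O n / M ^ n - F n / (n * M ^ n)| ≤ 2 * r ^ n := by
    have h2 : (n : ℝ) * O n ≤ F n := by exact_mod_cast hle n hn
    have h3 : (F n : ℝ) ≤ n * O n + n * (2 * M ^ (n / 2)) := by
      have : (F n : ℝ) ≤ n * O n + ((∑ d ∈ n.properDivisors, F d : ℕ) : ℝ) := by
        exact_mod_cast hge n hn
      linarith
    have h4 : (O n : ℝ) / M ^ n - F n / (n * M ^ n) = (n * O n - F n) / (n * M ^ n) := by
      field_simp
    have h5 : |(n : ℝ) * O n - F n| ≤ n * (2 * M ^ (n / 2)) := by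
      rw [abs_le]
      constructor <;> linarith [mul_nonneg hn0.le (by positivity : 0 ≤ 2 * M ^ (n / 2))]
    have h6 : M ^ (n / 2) ≤ √M ^ n := by
      calc M ^ (n / 2) = √M ^ (2 * (n / 2)) := by rw [pow_mul, Real.sq_sqrt hM0.le]
        _ ≤ √M ^ n := pow_le_pow_right₀ (Real.one_le_sqrt.2 hM.le) (Nat.mul_div_le n 2)
    have h7 : M ^ n = √M ^ n * √M ^ n := by rw [← mul_pow, Real.mul_self_sqrt hM0.le]
    rw [h4, abs_div, abs_of_pos (by positivity : 0 < (n : ℝ) * M ^ n)]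
    calc |(n : ℝ) * O n - F n| / (n * M ^ n) ≤ n * (2 * √M ^ n) / (n * M ^ n) := by
          gcongr
          exact h5.trans (by gcongr)
      _ = 2 * (1 / √M) ^ n := by
          rw [h7, div_pow, one_pow]
          field_simp
      _ ≤ 2 * r ^ n := by
          gcongr
          exact le_max_left _ _
  have h2 : |F n / (n * M ^ n) - f n / n| ≤ r ^ n := by
    have h3 : (F n : ℝ) / (n * M ^ n) - f n / n = (D n - M ^ n) * (f n / n) / M ^ n := by
      rw [hF n hn]
      field_simp
    have h4 : f n / n ≤ 1 := by
      rw [div_le_one hn0]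
      exact (hf1 n).trans (by exact_mod_cast hn)
    have h5 : 0 ≤ f n / n := div_nonneg (hf0 n) hn0.le
    rw [h3, abs_div, abs_of_pos hMn, abs_mul, abs_of_nonneg h5]
    calc |D n - M ^ n| * (f n / n) / M ^ n ≤ m ^ n * 1 / M ^ n := by
          gcongr
          exact hD n hn
      _ = (m / M) ^ n := by rw [mul_one, div_pow]
      _ ≤ r ^ n := by
          gcongr
          exact le_max_right _ _
  calc _ = |(O n / M ^ n - F n / (n * M ^ n)) + (F n / (n * M ^ n) - f n / n)| := by
        rw [sub_add_sub_cancel]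
    _ ≤ 2 * r ^ n + r ^ n := (abs_add_le _ _).trans (add_le_add h1 h2)
    _ = 3 * r ^ n := by ring

theorem abs_abs_pow_sub_pow_sub_le (a b : ℝ) (n : ℕ) :
    |(|a ^ n - b ^ n|) - (max |a| |b|) ^ n| ≤ (min |a| |b|) ^ n := by
  rcases le_total |a| |b| with h | h
  · rw [max_eq_right h, min_eq_left h, ← abs_pow, ← abs_pow, abs_sub_comm (a ^ n)]
    refine (abs_abs_sub_abs_le _ _).trans_eq ?_
    rw [sub_sub_cancel_left, abs_neg]
  · rw [max_eq_left h, min_eq_right h, ← abs_pow, ← abs_pow]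
    refine (abs_abs_sub_abs_le _ _).trans_eq ?_
    rw [sub_sub_cancel_left, abs_neg]

theorem natAbs_num_ne_den {S : Set Nat.Primes} {ξ : sIntegers S} (hξ : ¬ IsOfFinOrder ξ) :
    (ξ : ℚ).num.natAbs ≠ (ξ : ℚ).den := by
  intro h
  have hden : (ξ : ℚ).den = 1 := by
    have := (ξ : ℚ).reduced
    rwa [h, Nat.coprime_self] at this
  rw [hden] at h
  refine hξ (isOfFinOrder_iff_pow_eq_one.2 ⟨2, two_pos, Subtype.ext ?_⟩)
  have h1 : ((ξ : ℚ).num : ℚ) = ξ := Rat.den_eq_one_iff _ |>.1 hden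
  push_cast
  rw [← h1]
  rcases Int.natAbs_eq_iff.1 h with h | h <;> rw [h] <;> norm_num

theorem prod_padicNorm_int_mem_unitInterval (A : Finset ℕ) (hA : ∀ p ∈ A, p.Prime) (z : ℤ) :
    0 ≤ ∏ p ∈ A, padicNorm p z ∧ ∏ p ∈ A, padicNorm p z ≤ 1 := by
  refine ⟨Finset.prod_nonneg fun p _ => padicNorm.nonneg _,
    Finset.prod_le_one (fun p _ => padicNorm.nonneg _) fun p hp => ?_⟩
  have : Fact p.Prime := ⟨hA p hp⟩
  exact padicNorm.of_int z

theorem theorem1p3 (S : Set Nat.Primes) (hS : S.Finite)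
    (ξ : sIntegers S) (hξ0 : ξ ≠ 0) (hξ : ¬ IsOfFinOrder ξ) :
    (∀ n : ℕ, (closedOrbits (sIntegerMap S ξ) n).Finite) ∧
    0 < topologicalEntropy (sIntegerMap S ξ) ∧ topologicalEntropy (sIntegerMap S ξ) < ⊤ ∧
    ∃ (k : ℚ) (C : ℝ),
      ((fun N : ℕ => mertensSum (sIntegerMap S ξ) N - ((k : ℝ) * Real.log (N : ℝ) + C))
        =O[Filter.atTop] fun N : ℕ => 1 / (N : ℝ)) ∧
      ((ξ : ℚ) = 2 ∧ S = {⟨3, Nat.prime_three⟩} → k = 5 / 8) := by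
  classical
  set T := sIntegerMap S ξ
  set a := (ξ : ℚ).num with ha
  set b : ℤ := ((ξ : ℚ).den : ℤ) with hb
  set A : Finset ℕ := hS.toFinset.image (fun p : Nat.Primes => (p : ℕ)) with hAdef
  have hA : ∀ p : ℕ, p ∈ A ↔ ∃ q ∈ S, (q : ℕ) = p := fun p => by simp [hAdef]
  have hAp : ∀ p ∈ A, p.Prime := fun p hp => by
    obtain ⟨q, -, rfl⟩ := (hA p).1 hp
    exact q.2
  have hne : |a| ≠ |b| := by
    rw [Int.abs_eq_natAbs, Int.abs_eq_natAbs, hb, Int.natAbs_natCast]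
    exact_mod_cast natAbs_num_ne_den hξ
  have hD0 : ∀ n : ℕ, 0 < n → a ^ n - b ^ n ≠ 0 := by
    intro n hn h
    have h1 : |a| ^ n = |b| ^ n := by rw [← abs_pow, ← abs_pow, sub_eq_zero.1 h]
    exact hne ((pow_left_inj₀ (abs_nonneg a) (abs_nonneg b) hn.ne').1 h1)
  have hM : ((ratHeight (ξ : ℚ) : ℕ) : ℝ) = max |(a : ℝ)| |(b : ℝ)| := by
    rw [ratHeight, Nat.cast_max, Nat.cast_natAbs, Int.cast_abs, hb, Int.cast_natCast, Nat.abs_cast]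
  set M : ℝ := ((ratHeight (ξ : ℚ) : ℕ) : ℝ)
  set m : ℝ := min |(a : ℝ)| |(b : ℝ)| with hm
  have hneR : |(a : ℝ)| ≠ |(b : ℝ)| := by exact_mod_cast hne
  have hmM : m < M := by
    rw [hM, hm]
    exact min_lt_max.2 hneR
  have ha0 : a ≠ 0 := Rat.num_ne_zero.2 fun h => hξ0 (Subtype.ext h)
  have hb0 : b ≠ 0 := Int.natCast_ne_zero.2 (ξ : ℚ).den_ne_zero
  have hm1 : 1 ≤ m := le_min (by exact_mod_cast Int.one_le_abs ha0)
    (by exact_mod_cast Int.one_le_abs hb0)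
  have hM1 : 1 < M := hm1.trans_lt hmM
  have hcount := fun n (hn : 0 < n) => ncard_periodic_sIntegerMap ξ hA n (hD0 n hn)
  have hfin : ∀ n, 0 < n → {χ | T^[n] χ = χ}.Finite := fun n hn => (hcount n hn).1
  have hent : topologicalEntropy T = ((Real.log M : ℝ) : EReal) := topologicalEntropy_sIntegerMap ξ
  refine ⟨fun n => closedOrbits_finite T n (hfin n), ?_, ?_, ?_⟩
  · rw [hent]
    exact_mod_cast Real.log_pos hM1
  · rw [hent]
    exact EReal.coe_lt_top _
  set f : ℕ → ℝ := fun n => ((∏ p ∈ A, padicNorm p ((a ^ n - b ^ n : ℤ) : ℚ) : ℚ) : ℝ) with hf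
  have hf01 := fun n => prod_padicNorm_int_mem_unitInterval A hAp (a ^ n - b ^ n)
  have hgeom : ∀ n, 0 < n → |((closedOrbits T n).ncard : ℝ) / M ^ n - f n / n| ≤
      3 * (max (1 / √M) (m / M)) ^ n := by
    intro n hn
    refine abs_div_pow_sub_div_le hM1 (zero_le_one.trans hm1) hmM
      (F := fun n => {χ | T^[n] χ = χ}.ncard) (O := fun n => (closedOrbits T n).ncard)
      (D := fun n => |(a : ℝ) ^ n - (b : ℝ) ^ n|) (fun n => ?_) (fun n => ?_) (fun n hn => ?_)
      (fun n _ => ?_) (fun n hn => mul_ncard_closedOrbits_le T hn (hfin n hn))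
      (fun n hn => ncard_periodic_le T hn hfin) hn
    · exact Rat.cast_nonneg.2 (hf01 n).1
    · exact (Rat.cast_le.2 (hf01 n).2).trans_eq Rat.cast_one
    · have := congrArg (fun x : ℚ => (x : ℝ)) (hcount n hn).2
      simp only [Rat.cast_mul, Rat.cast_abs, Rat.cast_natCast, Rat.cast_intCast] at this
      rw [this, ← Int.cast_pow, ← Int.cast_pow, ← Int.cast_sub]
    · rw [hM]
      exact abs_abs_pow_sub_pow_sub_le _ _ n
  have hr1 : max (1 / √M) (m / M) < 1 := by
    refine max_lt ?_ ((div_lt_one (by linarith)).2 hmM)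
    rw [div_lt_one (Real.sqrt_pos.2 (by linarith))]
    exact Real.lt_sqrt_of_sq_lt (by linarith)
  have herr := convergesHarmonically_sum_of_geometric
    (le_max_of_le_left (by positivity)) hr1 hgeom
  have hmean : ∃ k : ℚ, HasBoundedMean f k ∧
      ((ξ : ℚ) = 2 ∧ S = {⟨3, Nat.prime_three⟩} → k = 5 / 8) := by
    -- The general argument does not expose the value of `k`, so the special case supplies its own
    -- computed mean.
    by_cases hspec : (ξ : ℚ) = 2 ∧ S = {⟨3, Nat.prime_three⟩}
    · refine ⟨5 / 8, ?_, fun _ => rfl⟩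
      have hA3 : A = {3} := by
        ext p
        rw [hA, hspec.2, Finset.mem_singleton]
        constructor
        · rintro ⟨q, hq, rfl⟩
          rw [Set.mem_singleton_iff.1 hq]
        · rintro rfl
          exact ⟨_, rfl, rfl⟩
      have ha2 : a = 2 := by rw [ha, hspec.1]; rfl
      have hb1 : b = 1 := by rw [hb, hspec.1]; rfl
      have h := hasBoundedMean_padicNorm_three_two_pow_sub_one
      simp only [hf, hA3, ha2, hb1, Finset.prod_singleton]
      convert h using 1
      norm_num
    · obtain ⟨k, hk⟩ := exists_hasBoundedMean_prod_pow_sub_pow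
        (ξ : ℚ).isCoprime_num_den hD0 A hAp
      exact ⟨k, hk, fun h => absurd h hspec⟩
  obtain ⟨k, hk, hk58⟩ := hmean
  obtain ⟨C, hC⟩ := herr.add hk.convergesHarmonically
  refine ⟨k, C, hC.congr_left fun N => ?_, hk58⟩
  have hmert : mertensSum T N = ∑ n ∈ Finset.Icc 1 N, ((closedOrbits T n).ncard : ℝ) / M ^ n := by
    refine Finset.sum_congr rfl fun n _ => ?_
    rw [hent, EReal.toReal_coe, div_eq_mul_inv, Real.exp_neg, mul_comm (Real.log M), Real.exp_nat_mul,
      Real.exp_log (by linarith)]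
  simp only
  rw [hmert, Finset.sum_sub_distrib]
  ring
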